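/- Notation. For real $p>0$ and a real vector $v$ let $\|v\|_p=(\sum_i|v_i|^p)^{1/p}$. Let $0<p<2$, and let $A$ be an $n\times d$ real matrix of rank $d$ with rows $a_1^T,\dots,a_n^T$. The $\ell_p$ Lewis weights of $A$ are the unique nonnegative weights $\bar w_1,\dots,\bar w_n$ such that, with $\bar W=\mathrm{diag}(\bar w)$, the matrix $A^T\bar W^{1-2/p}A$ is invertible and $a_i^T(A^T\bar W^{1-2/p}A)^{-1}a_i=\bar w_i^{2/p}$ for all $i$ (zero rows have weight $0$ and contribute nothing to $A^T\bar W^{1-2/p}A$). For $\alpha\ge 1$ write $x\approx_\alpha y$ if $\frac1\alpha x\le y\le\alpha x$. For real $q_1,\dots,q_n\ge 0$ with $\sum_i q_i=N\in\mathbb N$, $N\ge 1$, let $S$ be the random $N\times n$ matrix whose rows are chosen independently, each being $q_i^{-1/p}$ times the $i$-th standard basis vector with probability $q_i/N$. Lemma. For every $p_0>0$ there is a constant $C_2>0$ depending only on $p_0$, and for every $c>0$ a constant $C_1\in\mathbb N$ depending only on $p_0$ and $c$, such that the following holds. (In particular, taking $p_0=1$, the constants do not depend on $p$ in the range $1\le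 p<2$.) Let $p_0\le p<2$, $d\ge1$, $N\in\mathbb N$, $\epsilon,\delta\in(0,1]$, $l\ge 1$ real, let $g$ be a real-valued function of $(p,n,d,\epsilon,\delta)$, and put $$U=g(p,\;N+C_1d^2,\;d,\;\epsilon/C_2,\;\delta).$$ Assume that $\frac1U\ge\frac cd$, and that for every $(N+C_1d^2)\times d$ matrix $B$ of rank $d$, with rows $b_i^T$, all of whose $\ell_p$ Lewis weights are at most $\frac1U$, $$\mathbb E_\sigma\Big[\Big(\max_{\|Bx\|_p=1}\Big|\sum_i\sigma_i|b_i^Tx|^p\Big|\Big)^l\Big]\le(\epsilon/C_2)^l\,\delta ,$$ where the $\sigma_i$ are independent uniform $\pm1$ signs. Then for every $n$, every $n\times d$ matrix $A$ of rank $d$ with $\ell_p$ Lewis weights $\bar w$, and all real $q_1,\dots,q_n$ with $\sum_iq_i=N$ and $q_i\ge U\,\bar w_i$ for all $i$, $$\mathbb E_S\Big[\Big(\max_{\|Ax\|_p=1}\big|\|SAx\|_p^p-1\big|\Big)^l\Big]\le\epsilon^l\,\delta ,$$ and, with probability at least $1-\delta$, $\|SAx\|_p\approx_{1+\epsilon}\|Ax\|_p$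 holds for all $x\in\mathbb R^d$ simultaneously. -/

import Mathlib

open scoped BigOperators Matrix

noncomputable section

namespace LewisSampling

/-- The `ℓ_p` (quasi-)norm `(∑ i, |v i| ^ p) ^ (1 / p)` of a real vector. -/
def lpNorm {n : ℕ} (p : ℝ) (v : Fin n → ℝ) : ℝ :=
  (∑ i, |v i| ^ p) ^ (1 / p)

/-- `x ≈_α y`, that is `x / α ≤ y ≤ α x`. -/
def Approx (α x y : ℝ) : Prop :=
  1 / α * x ≤ y ∧ y ≤ α * x

/-- The weighted Gram matrix `Aᵀ W ^ (1 - 2 / p) A`, where `W` is the diagonal matrix of `w`.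
For `p < 2` the exponent is negative, and `0` to that power is `0`: a row of weight zero
contributes nothing. -/
def lewisGram {n d : ℕ} (p : ℝ) (A : Matrix (Fin n) (Fin d) ℝ) (w : Fin n → ℝ) :
    Matrix (Fin d) (Fin d) ℝ :=
  Aᵀ * Matrix.diagonal (fun i => w i ^ (1 - 2 / p)) * A

/-- `w` is the vector of `ℓ_p` Lewis weights of `A`: the weights are nonnegative and
`a_iᵀ (Aᵀ W ^ (1 - 2 / p) A)⁻¹ a_i = w_i ^ (2 / p)` for every row `a_i`, where the matrix that is
inverted is nonsingular. The nonsingularity entails that `A` has full column rank, and that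
exactly the zero rows of `A` have weight zero. -/
structure IsLewisWeights {n d : ℕ} (p : ℝ) (A : Matrix (Fin n) (Fin d) ℝ) (w : Fin n → ℝ) :
    Prop where
  nonneg : ∀ i, 0 ≤ w i
  isUnit_det : IsUnit (lewisGram p A w).det
  eq_rpow : ∀ i, A i ⬝ᵥ ((lewisGram p A w)⁻¹ *ᵥ A i) = w i ^ (2 / p)

/-- `max_{‖A x‖_p = 1} |∑ i, σ_i |a_iᵀ x| ^ p|` for a vector of signs `σ`. For `A` of full column
rank the set over which the supremum is taken is compact, so the supremum is a maximum. -/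
def rademacherMax {n d : ℕ} (p : ℝ) (A : Matrix (Fin n) (Fin d) ℝ) (σ : Fin n → ℤˣ) : ℝ :=
  ⨆ x : {x : Fin d → ℝ // lpNorm p (A *ᵥ x) = 1},
    |∑ i, ((σ i : ℤ) : ℝ) * |(A *ᵥ x.1) i| ^ p|

/-- A uniform bound `U` on Lewis weights implies the moment bound `ε ^ l * δ`: whenever an
`n × d` matrix has all its Lewis weights at most `U`, the `l`-th moment of its Rademacher process
is at most `ε ^ l * δ` (the expectation is over independent uniform signs). -/
def UniformMomentBound (p : ℝ) (n d : ℕ) (U l ε δ : ℝ) : Prop :=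
  ∀ (A : Matrix (Fin n) (Fin d) ℝ) (w : Fin n → ℝ), IsLewisWeights p A w → (∀ i, w i ≤ U) →
    (𝔼 σ : Fin n → ℤˣ, rademacherMax p A σ ^ l) ≤ ε ^ l * δ

/-- The sampling matrix `S` for the drawn indices `s`: its `k`-th row is the `s k`-th standard
basis vector times `1 / q_{s k} ^ (1 / p)`. -/
def samplingMatrix {n N : ℕ} (p : ℝ) (q : Fin n → ℝ) (s : Fin N → Fin n) :
    Matrix (Fin N) (Fin n) ℝ :=
  Matrix.of fun k i => if i = s k then 1 / q i ^ (1 / p) else 0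

/-- The probability of drawing the index sequence `s`, when the `N` indices are drawn
independently, each equal to `i` with probability `q_i / N`. -/
def sampleProb {n N : ℕ} (q : Fin n → ℝ) (s : Fin N → Fin n) : ℝ :=
  ∏ k, q (s k) / N

/-- `max_{‖A x‖_p = 1} |‖S A x‖_p ^ p - 1|`. For `A` of full column rank the set over which the
supremum is taken is compact, so the supremum is a maximum. -/
def samplingError {n N d : ℕ} (p : ℝ) (A : Matrix (Fin n) (Fin d) ℝ)
    (S : Matrix (Fin N) (Fin n) ℝ) : ℝ :=
  ⨆ x : {x : Fin d → ℝ // lpNorm p (A *ᵥ x) = 1}, |lpNorm p ((S * A) *ᵥ x.1) ^ p - 1|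

/-- The expectation of `F S` over the random sampling matrix `S`. -/
def sampleExpectation {n N : ℕ} (p : ℝ) (q : Fin n → ℝ)
    (F : Matrix (Fin N) (Fin n) ℝ → ℝ) : ℝ :=
  ∑ s : Fin N → Fin n, sampleProb q s * F (samplingMatrix p q s)

open Classical in
/-- The probability of the event `E` under the random sampling matrix `S`. -/
def sampleProbability {n N : ℕ} (p : ℝ) (q : Fin n → ℝ)
    (E : Matrix (Fin N) (Fin n) ℝ → Prop) : ℝ :=
  ∑ s : Fin N → Fin n, if E (samplingMatrix p q s) then sampleProb q s else 0

end LewisSampling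

end

noncomputable section

namespace LewisSampling

/-! ### Lewis weights: existence and comparison -/

/-! Symmetrization bounds the `l`-th moment of the sampling error `Z` by `2 ^ l` times that of the
Rademacher sums of the sampled rows. The hypothesis cannot be applied to `S A` itself: a sample may
miss directions, and then its Lewis weights are not small. So `m = C₁ d ^ 2` rows are appended to `S
A`. They come from a sparsification of `A` fixed before sampling, and they must do two things.

First, their quadratic form dominates the Lewis Gram matrix of `A`. Then the weights `1 / U` on
sampled rows and `2 d / m ≤ 1 / U` on appended rows overestimate the Lewis weights of the augmented
matrix. Since the Lewis iteration is monotone and contracting for `p < 2`, overestimates bound the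
true weights (`exists_isLewisWeights_le`), and the hypothesis applies.

Second, they add at most a constant multiple of `‖A x‖_p ^ p`, so on the unit sphere of `A` the
augmented matrix has `p`-th power norm at most `k + Z`, with `k` depending only on `p₀`. Extra
symmetric terms cannot lower a Rademacher moment, hence `E Z ^ l ≤ 2 ^ l * (2 ^ l / 2) * η * (k ^ l
+ E Z ^ l)`, where `η = (ε / C₂) ^ l * δ` is the assumed moment bound. For large `C₂` the last term
is absorbed on the left.

The sparsification (`exists_sparsification`) is probabilistic. In coordinates where the Lewis system
is isotropic, sampling by Lewis weight keeps the quadratic form by a Frobenius second moment, which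
is where `d ^ 2` rows enter. The `ℓ_p` bound comes from an exponential moment averaged over the unit
ball and a volume argument, valid for quasi-norms too. -/

lemma two_mul_dotProduct_sub_le {d : ℕ} {G : Matrix (Fin d) (Fin d) ℝ} (hG : G.PosDef)
    (x z : Fin d → ℝ) : 2 * (x ⬝ᵥ z) - z ⬝ᵥ (G *ᵥ z) ≤ x ⬝ᵥ (G⁻¹ *ᵥ x) := by
  have hdet : IsUnit G.det := (Matrix.isUnit_iff_isUnit_det _).1 hG.isUnit
  have h := hG.posSemidef.dotProduct_mulVec_nonneg (z - G⁻¹ *ᵥ x)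
  have hx : G *ᵥ (G⁻¹ *ᵥ x) = x := by
    rw [Matrix.mulVec_mulVec, Matrix.mul_nonsing_inv _ hdet, Matrix.one_mulVec]
  have hsymm : Gᵀ = G := by simpa using hG.isHermitian.eq
  have hs : (G⁻¹ *ᵥ x) ⬝ᵥ (G *ᵥ z) = x ⬝ᵥ z := by
    rw [Matrix.dotProduct_mulVec, ← Matrix.mulVec_transpose, hsymm, hx]
  rw [star_trivial, Matrix.mulVec_sub, hx, sub_dotProduct, dotProduct_sub, dotProduct_sub, hs,
    dotProduct_comm z x, dotProduct_comm (G⁻¹ *ᵥ x) x] at h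
  linarith

/-- Inversion reverses the Loewner order. The form of `G⁻¹` at `x` is the maximum over `z` of `2 (x
⬝ᵥ z) - z ⬝ᵥ (G *ᵥ z)`; testing with `z = r H⁻¹ x` gives the claim. -/
lemma dotProduct_inv_mulVec_le {d : ℕ} {G H : Matrix (Fin d) (Fin d) ℝ} (hG : G.PosDef)
    (hH : H.PosDef) {r : ℝ} (hr : 0 < r)
    (hGH : ∀ z, r * (z ⬝ᵥ (G *ᵥ z)) ≤ z ⬝ᵥ (H *ᵥ z)) (x : Fin d → ℝ) :
    x ⬝ᵥ (H⁻¹ *ᵥ x) ≤ r⁻¹ * (x ⬝ᵥ (G⁻¹ *ᵥ x)) := by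
  have hdet : IsUnit H.det := (Matrix.isUnit_iff_isUnit_det _).1 hH.isUnit
  set z := H⁻¹ *ᵥ x with hz
  have hx : H *ᵥ z = x := by
    rw [hz, Matrix.mulVec_mulVec, Matrix.mul_nonsing_inv _ hdet, Matrix.one_mulVec]
  have h1 := two_mul_dotProduct_sub_le hG x (r • z)
  have h2 := hGH z
  rw [hx, dotProduct_comm z x] at h2
  rw [Matrix.mulVec_smul, dotProduct_smul, dotProduct_smul, smul_dotProduct] at h1
  simp only [smul_eq_mul] at h1
  rw [le_inv_mul_iff₀ hr]
  nlinarith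

lemma dotProduct_lewisGram_mulVec {n d : ℕ} (p : ℝ) (A : Matrix (Fin n) (Fin d) ℝ)
    (w : Fin n → ℝ) (z : Fin d → ℝ) :
    z ⬝ᵥ (lewisGram p A w *ᵥ z) = ∑ i, w i ^ (1 - 2 / p) * (A i ⬝ᵥ z) ^ 2 := by
  rw [lewisGram, ← Matrix.mulVec_mulVec, ← Matrix.mulVec_mulVec, Matrix.dotProduct_mulVec,
    Matrix.vecMul_transpose, dotProduct]
  refine Finset.sum_congr rfl fun i _ => ?_
  rw [Matrix.mulVec_diagonal]
  change (A i ⬝ᵥ z) * (_ * (A i ⬝ᵥ z)) = _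
  ring

lemma lewisGram_congr {n d : ℕ} {p : ℝ} {A : Matrix (Fin n) (Fin d) ℝ} {w w' : Fin n → ℝ}
    (h : ∀ i, A i ≠ 0 → w i = w' i) : lewisGram p A w = lewisGram p A w' := by
  ext a b
  rw [lewisGram, lewisGram, Matrix.mul_apply, Matrix.mul_apply]
  refine Finset.sum_congr rfl fun i _ => ?_
  rw [Matrix.mul_diagonal, Matrix.mul_diagonal]
  by_cases hi : A i = 0
  · simp [hi]
  · rw [h i hi]

lemma isHermitian_lewisGram {n d : ℕ} (p : ℝ) (A : Matrix (Fin n) (Fin d) ℝ)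
    (w : Fin n → ℝ) : (lewisGram p A w).IsHermitian := by
  simp [Matrix.IsHermitian, lewisGram, Matrix.mul_assoc]

lemma posDef_lewisGram_iff {n d : ℕ} (p : ℝ) (A : Matrix (Fin n) (Fin d) ℝ) (w : Fin n → ℝ) :
    (lewisGram p A w).PosDef ↔
      ∀ z, z ≠ 0 → 0 < ∑ i, w i ^ (1 - 2 / p) * (A i ⬝ᵥ z) ^ 2 := by
  rw [Matrix.posDef_iff_dotProduct_mulVec]
  simp only [star_trivial, dotProduct_lewisGram_mulVec]
  exact ⟨fun h z hz => h.2 hz, fun h => ⟨isHermitian_lewisGram p A w, fun z hz => h z hz⟩⟩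

/-- Definiteness only requires that every `z ≠ 0` is seen by some row, which does not depend on the
choice of positive weights. -/
lemma posDef_lewisGram_of_pos {n d : ℕ} {p : ℝ} {A : Matrix (Fin n) (Fin d) ℝ}
    {v y : Fin n → ℝ} (h : (lewisGram p A v).PosDef) (hy : ∀ i, 0 < y i) :
    (lewisGram p A y).PosDef := by
  rw [posDef_lewisGram_iff] at h ⊢
  intro z hz
  obtain ⟨i, -, hi⟩ := Finset.exists_ne_zero_of_sum_ne_zero (h z hz).ne'
  have hAi : A i ⬝ᵥ z ≠ 0 := fun h0 => hi (by simp [h0])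
  refine Finset.sum_pos' (fun j _ => ?_) ⟨i, Finset.mem_univ _, ?_⟩
  · have := hy j
    positivity
  · have := hy i
    positivity

lemma IsLewisWeights.posDef {n d : ℕ} {p : ℝ} {A : Matrix (Fin n) (Fin d) ℝ} {w : Fin n → ℝ}
    (h : IsLewisWeights p A w) : (lewisGram p A w).PosDef := by
  have hps : (lewisGram p A w).PosSemidef := by
    refine Matrix.PosSemidef.of_dotProduct_mulVec_nonneg (isHermitian_lewisGram p A w) fun z => ?_
    rw [star_trivial, dotProduct_lewisGram_mulVec]
    exact Finset.sum_nonneg fun i _ =>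
      mul_nonneg (Real.rpow_nonneg (h.nonneg i) _) (sq_nonneg _)
  rw [hps.posDef_iff_det_ne_zero]
  exact h.isUnit_det.ne_zero

lemma dotProduct_inv_lewisGram_mulVec_le {n d : ℕ} {p : ℝ} (hp : 0 < p) (hp2 : p < 2)
    {A : Matrix (Fin n) (Fin d) ℝ} {y y' : Fin n → ℝ}
    (hy : ∀ i, 0 < y i) (hy' : ∀ i, 0 < y' i)
    (h : (lewisGram p A y).PosDef) {c : ℝ} (hc : 0 < c) (hyy : ∀ i, y i ≤ c * y' i)
    (x : Fin d → ℝ) :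
    x ⬝ᵥ ((lewisGram p A y)⁻¹ *ᵥ x) ≤
      c ^ (2 / p - 1) * (x ⬝ᵥ ((lewisGram p A y')⁻¹ *ᵥ x)) := by
  have hexp : 1 - 2 / p ≤ 0 := by
    rw [sub_nonpos, le_div_iff₀ hp]
    linarith
  have h1 := dotProduct_inv_mulVec_le (posDef_lewisGram_of_pos h hy') h
    (Real.rpow_pos_of_pos hc (1 - 2 / p)) (fun z => ?_) x
  · rwa [← Real.rpow_neg hc.le, neg_sub] at h1
  · rw [dotProduct_lewisGram_mulVec, dotProduct_lewisGram_mulVec, Finset.mul_sum]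
    refine Finset.sum_le_sum fun i _ => ?_
    rw [← mul_assoc, ← Real.mul_rpow hc.le (hy' i).le]
    exact mul_le_mul_of_nonneg_right
      (Real.rpow_le_rpow_of_nonpos (hy i) (hyy i) hexp) (sq_nonneg _)

/-- The Lewis iteration `w ↦ (a_iᵀ (Aᵀ W ^ (1 - 2 / p) A)⁻¹ a_i) ^ (p / 2)`, in logarithmic
coordinates. -/
def logLewisMap {n d : ℕ} (p : ℝ) (A : Matrix (Fin n) (Fin d) ℝ) (t : Fin n → ℝ) : Fin n → ℝ :=
  fun i => p / 2 *
    Real.log (A i ⬝ᵥ ((lewisGram p A fun j => Real.exp (t j))⁻¹ *ᵥ A i))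

/-- Since `1 - 2 / p < 0`, multiplying the weights by at most `e ^ c` costs a factor `e ^ (c (2 / p
- 1))` in the inverse Gram matrix, and the power `p / 2` turns it into `e ^ (c (1 - p / 2))`. This
one-sided form serves both the contraction and the comparison with an overestimate. -/
lemma logLewisMap_le {n d : ℕ} {p : ℝ} (hp : 0 < p) (hp2 : p < 2)
    {A : Matrix (Fin n) (Fin d) ℝ} (h : (lewisGram p A fun _ => 1).PosDef) {t t' : Fin n → ℝ}
    {c : ℝ} (htt : ∀ i, t i ≤ t' i + c) {i : Fin n} (hi : A i ≠ 0) :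
    logLewisMap p A t i ≤ logLewisMap p A t' i + (1 - p / 2) * c := by
  have hpos : ∀ s : Fin n → ℝ, (lewisGram p A fun j => Real.exp (s j)).PosDef := fun s =>
    posDef_lewisGram_of_pos h fun j => Real.exp_pos _
  have hq : ∀ s : Fin n → ℝ, 0 < A i ⬝ᵥ ((lewisGram p A fun j => Real.exp (s j))⁻¹ *ᵥ A i) :=
    fun s => by simpa using (hpos s).inv.dotProduct_mulVec_pos hi
  have h1 := dotProduct_inv_lewisGram_mulVec_le hp hp2 (fun j => Real.exp_pos (t j))
    (fun j => Real.exp_pos (t' j)) (hpos t) (Real.exp_pos c)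
    (fun j => by rw [← Real.exp_add, add_comm]; exact Real.exp_le_exp.2 (htt j)) (A i)
  have h2 := Real.log_le_log (hq t) h1
  rw [Real.log_mul (by positivity) (hq t').ne', Real.log_rpow (Real.exp_pos c),
    Real.log_exp] at h2
  have h3 := mul_le_mul_of_nonneg_left h2 (by positivity : 0 ≤ p / 2)
  have h4 : p / 2 * ((2 / p - 1) * c) = (1 - p / 2) * c := by
    field_simp
  unfold logLewisMap
  linarith [mul_add (p / 2) ((2 / p - 1) * c)
    (Real.log (A i ⬝ᵥ ((lewisGram p A fun j => Real.exp (t' j))⁻¹ *ᵥ A i)))]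

/-- Banach's fixed point theorem in the sup norm, with ratio `1 - p / 2 < 1`. -/
lemma exists_logLewisMap_eq {n d : ℕ} {p : ℝ} (hp : 0 < p) (hp2 : p < 2)
    {A : Matrix (Fin n) (Fin d) ℝ} (h : (lewisGram p A fun _ => 1).PosDef) :
    ∃ t, logLewisMap p A t = t := by
  have hK : 0 ≤ 1 - p / 2 := by linarith
  have hc : ContractingWith (1 - p / 2).toNNReal (logLewisMap p A) := by
    refine ⟨by rw [Real.toNNReal_lt_one]; linarith, LipschitzWith.of_dist_le_mul fun s t => ?_⟩
    refine (dist_pi_le_iff (by positivity)).2 fun i => ?_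
    rw [Real.coe_toNNReal _ hK]
    -- A zero row gives the constant coordinate `p / 2 * log 0 = 0`.
    by_cases hi : A i = 0
    · simp only [logLewisMap, hi, zero_dotProduct, Real.log_zero, mul_zero, dist_self]
      positivity
    · have hd : ∀ j, |s j - t j| ≤ dist s t := fun j => by
        rw [← Real.dist_eq]
        exact dist_le_pi_dist s t j
      have h1 := logLewisMap_le hp hp2 h (t := s) (t' := t) (c := dist s t)
        (fun j => by linarith [(abs_le.1 (hd j)).2]) hi
      have h2 := logLewisMap_le hp hp2 h (t := t) (t' := s) (c := dist s t)
        (fun j => by linarith [(abs_le.1 (hd j)).1]) hi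
      rw [Real.dist_eq, abs_le]
      constructor <;> linarith
  exact ⟨_, hc.fixedPoint_isFixedPt⟩

/-- If the positive weights `v` overestimate the Lewis weights in the sense that
`a_iᵀ (Aᵀ V ^ (1 - 2 / p) A)⁻¹ a_i ≤ v_i ^ (2 / p)`, then `A` has Lewis weights, and they are
at most `v`. -/
theorem exists_isLewisWeights_le {n d : ℕ} {p : ℝ} (hp : 0 < p) (hp2 : p < 2)
    {A : Matrix (Fin n) (Fin d) ℝ} {v : Fin n → ℝ} (hv : ∀ i, 0 < v i)
    (hG : (lewisGram p A v).PosDef)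
    (hle : ∀ i, A i ⬝ᵥ ((lewisGram p A v)⁻¹ *ᵥ A i) ≤ v i ^ (2 / p)) :
    ∃ w, IsLewisWeights p A w ∧ ∀ i, w i ≤ v i := by
  have h1 : (lewisGram p A fun _ => 1).PosDef := posDef_lewisGram_of_pos hG fun _ => one_pos
  obtain ⟨t, ht⟩ := exists_logLewisMap_eq hp hp2 h1
  have hGt : (lewisGram p A fun j => Real.exp (t j)).PosDef :=
    posDef_lewisGram_of_pos h1 fun j => Real.exp_pos _
  have hq : ∀ i, A i ≠ 0 →
      0 < A i ⬝ᵥ ((lewisGram p A fun j => Real.exp (t j))⁻¹ *ᵥ A i) := fun i hi => by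
    simpa using hGt.inv.dotProduct_mulVec_pos hi
  set w : Fin n → ℝ := fun i => if A i = 0 then 0 else Real.exp (t i) with hw
  have hGw : lewisGram p A w = lewisGram p A fun j => Real.exp (t j) := by
    exact lewisGram_congr fun i hi => by simp [hw, hi]
  refine ⟨w, ⟨fun i => ?_, ?_, fun i => ?_⟩, ?_⟩
  · simp only [hw]
    split_ifs <;> positivity
  · rw [hGw]
    exact (Matrix.isUnit_iff_isUnit_det _).1 hGt.isUnit
  · rw [hGw]
    by_cases hi : A i = 0
    · have : (2 / p : ℝ) ≠ 0 := by positivity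
      simp [hw, hi, Real.zero_rpow this]
    · have hti : t i = p / 2 *
          Real.log (A i ⬝ᵥ ((lewisGram p A fun j => Real.exp (t j))⁻¹ *ᵥ A i)) :=
        (congrFun ht i).symm
      simp only [hw, hi, if_false]
      rw [← Real.exp_mul, hti]
      conv_lhs => rw [← Real.exp_log (hq i hi)]
      congr 1
      field_simp
  · classical
    have hlog : ∀ i, A i ≠ 0 → logLewisMap p A (fun j => Real.log (v j)) i ≤ Real.log (v i) := by
      intro i hi
      have hexp : (fun j => Real.exp (Real.log (v j))) = v := funext fun j => Real.exp_log (hv j)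
      have h2 : 0 < A i ⬝ᵥ ((lewisGram p A v)⁻¹ *ᵥ A i) := by
        simpa using hG.inv.dotProduct_mulVec_pos hi
      have h3 := Real.log_le_log h2 (hle i)
      rw [Real.log_rpow (hv i)] at h3
      unfold logLewisMap
      rw [hexp]
      calc _ ≤ p / 2 * (2 / p * Real.log (v i)) := by gcongr
        _ = _ := by field_simp
    -- Maximum principle: if the largest excess `c` of `t` over `log v` were positive, applying the
    -- map would bound it by `(1 - p / 2) c < c`.
    have key : ∀ i, A i ≠ 0 → t i ≤ Real.log (v i) := by
      by_contra! hcon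
      obtain ⟨i₀, hi₀, hlt₀⟩ := hcon
      obtain ⟨i, hi, hmax⟩ := Finset.exists_max_image (Finset.univ.filter fun i => A i ≠ 0)
        (fun i => t i - Real.log (v i)) ⟨i₀, by simpa using hi₀⟩
      simp only [Finset.mem_filter, Finset.mem_univ, true_and] at hi hmax
      have hm₀ := hmax i₀ hi₀
      set c := t i - Real.log (v i) with hc
      -- zero rows do not enter the Gram matrix
      set t' : Fin n → ℝ := fun j => if A j = 0 then Real.log (v j) else t j with ht'
      have hmap : logLewisMap p A t' = logLewisMap p A t := by
        have : (lewisGram p A fun j => Real.exp (t' j)) =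
            lewisGram p A fun j => Real.exp (t j) := by
          exact lewisGram_congr fun i hi => by simp [ht', hi]
        unfold logLewisMap
        rw [this]
      have h2 := logLewisMap_le hp hp2 h1 (t := t') (t' := fun j => Real.log (v j)) (c := c)
        (fun j => ?_) hi
      · have h3 := hlog i hi
        rw [hmap, ht] at h2
        nlinarith
      · simp only [ht']
        split_ifs with hj
        · linarith
        · linarith [hmax j hj]
    intro i
    simp only [hw]
    split_ifs with hi
    · exact (hv i).le
    · rw [← Real.exp_log (hv i)]
      exact Real.exp_le_exp.2 (key i hi)

/-! ### Independent samples from a finite set -/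

section Sampling

variable {ι : Type*} [Fintype ι]

lemma sum_prod_apply {m : ℕ} (h : Fin m → ι → ℝ) :
    ∑ s : Fin m → ι, ∏ k, h k (s k) = ∏ k, ∑ i, h k i := by
  rw [Finset.prod_univ_sum, Fintype.piFinset_univ]

lemma sum_prod_eq_one {π : ι → ℝ} (hπ : ∑ i, π i = 1) (m : ℕ) :
    ∑ s : Fin m → ι, ∏ k, π (s k) = 1 := by
  rw [sum_prod_apply fun _ => π]
  simp [hπ]

lemma sum_prod_mul_apply {m : ℕ} {π : ι → ℝ} (hπ : ∑ i, π i = 1) (f : ι → ℝ) (k : Fin m) :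
    ∑ s : Fin m → ι, (∏ j, π (s j)) * f (s k) = ∑ i, π i * f i := by
  have h := sum_prod_apply (m := m) fun j i => π i * if j = k then f i else 1
  simp only [Finset.prod_mul_distrib, Finset.prod_ite_eq', Finset.mem_univ, if_true] at h
  rw [h, Finset.prod_eq_single k]
  · simp
  · intro j _ hj
    simp [hj, hπ]
  · simp

/-- Variances of independent centred variables add: the cross terms factor through a vanishing mean.
-/
lemma sum_prod_mul_sq_sum {m : ℕ} {π : ι → ℝ} (hπ : ∑ i, π i = 1) {ξ : ι → ℝ}
    (hξ : ∑ i, π i * ξ i = 0) :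
    ∑ s : Fin m → ι, (∏ j, π (s j)) * (∑ k, ξ (s k)) ^ 2 = m * ∑ i, π i * ξ i ^ 2 := by
  have hoff : ∀ k l : Fin m, k ≠ l →
      ∑ s : Fin m → ι, (∏ j, π (s j)) * (ξ (s k) * ξ (s l)) = 0 := by
    intro k l hkl
    have h := sum_prod_apply (m := m) fun j i =>
      π i * ((if j = k then ξ i else 1) * if j = l then ξ i else 1)
    simp only [Finset.prod_mul_distrib, Finset.prod_ite_eq', Finset.mem_univ, if_true] at h
    rw [h]
    refine Finset.prod_eq_zero (Finset.mem_univ k) ?_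
    simp [hkl, hξ]
  calc ∑ s : Fin m → ι, (∏ j, π (s j)) * (∑ k, ξ (s k)) ^ 2
      = ∑ k, ∑ l, ∑ s : Fin m → ι, (∏ j, π (s j)) * (ξ (s k) * ξ (s l)) := by
        simp_rw [sq, Finset.sum_mul_sum, Finset.mul_sum]
        rw [Finset.sum_comm]
        exact Finset.sum_congr rfl fun k _ => Finset.sum_comm
    _ = ∑ k : Fin m, ∑ i, π i * ξ i ^ 2 := by
        refine Finset.sum_congr rfl fun k _ => ?_
        rw [Finset.sum_eq_single k (fun l _ hl => hoff k l hl.symm) (by simp),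
          ← sum_prod_mul_apply hπ (fun i => ξ i ^ 2) k]
        simp only [sq]
    _ = m * ∑ i, π i * ξ i ^ 2 := by simp

lemma exists_le_of_sum_mul_le {κ : Type*} [Fintype κ] {P F : κ → ℝ} (hP : ∀ s, 0 ≤ P s)
    (hP1 : ∑ s, P s = 1) {b : ℝ} (h : ∑ s, P s * F s ≤ b) : ∃ s, F s ≤ b := by
  by_contra! hcon
  obtain ⟨s, -, hs⟩ := Finset.exists_ne_zero_of_sum_ne_zero (hP1 ▸ one_ne_zero : ∑ s, P s ≠ 0)
  have : ∑ s, P s * b < ∑ s, P s * F s :=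
    Finset.sum_lt_sum (fun t _ => mul_le_mul_of_nonneg_left (hcon t).le (hP t))
      ⟨s, Finset.mem_univ _, mul_lt_mul_of_pos_left (hcon s) ((hP s).lt_of_ne' hs)⟩
  rw [← Finset.sum_mul, hP1, one_mul] at this
  linarith

end Sampling

/-! ### A volume argument for quasi-norms -/

/-- From `(a + b) ^ 2 ≤ 2 (a ^ 2 + b ^ 2)` and subadditivity of `t ^ (p / 2)`; this treats `p < 1`
and `p ≥ 1` alike. -/
lemma abs_add_rpow_le {p : ℝ} (hp : 0 < p) (hp2 : p ≤ 2) (a b : ℝ) :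
    |a + b| ^ p ≤ 2 * (|a| ^ p + |b| ^ p) := by
  have hsq : ∀ t : ℝ, |t| ^ p = (t ^ 2) ^ (p / 2) := fun t => by
    rw [← sq_abs, ← Real.rpow_natCast, ← Real.rpow_mul (abs_nonneg _)]
    congr 1
    push_cast
    ring
  have h2 : (2 : ℝ) ^ (p / 2) ≤ 2 := by
    calc (2 : ℝ) ^ (p / 2) ≤ 2 ^ (1 : ℝ) :=
          Real.rpow_le_rpow_of_exponent_le one_le_two (by linarith)
      _ = 2 := Real.rpow_one 2
  rw [hsq, hsq, hsq]
  calc ((a + b) ^ 2) ^ (p / 2) ≤ (2 * (a ^ 2 + b ^ 2)) ^ (p / 2) :=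
        Real.rpow_le_rpow (sq_nonneg _) (by nlinarith [sq_nonneg (a - b)]) (by linarith)
    _ = 2 ^ (p / 2) * (a ^ 2 + b ^ 2) ^ (p / 2) := Real.mul_rpow (by norm_num) (by positivity)
    _ ≤ 2 * ((a ^ 2) ^ (p / 2) + (b ^ 2) ^ (p / 2)) := by
        gcongr
        exact Real.rpow_add_le_add_rpow (sq_nonneg _) (sq_nonneg _) (by linarith) (by linarith)

/-- The quasi-norm power `x ↦ ∑ i, w_i |u_iᵀ x| ^ p`. -/
def lpForm {ι : Type*} [Fintype ι] {d : ℕ} (p : ℝ) (w : ι → ℝ) (u : ι → Fin d → ℝ)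
    (x : Fin d → ℝ) : ℝ :=
  ∑ i, w i * |u i ⬝ᵥ x| ^ p

section lpForm

variable {ι : Type*} [Fintype ι] {d : ℕ} {p : ℝ} {w : ι → ℝ} {u : ι → Fin d → ℝ}

lemma lpForm_nonneg (hw : ∀ i, 0 ≤ w i) (x : Fin d → ℝ) : 0 ≤ lpForm p w u x :=
  Finset.sum_nonneg fun i _ => mul_nonneg (hw i) (by positivity)

lemma continuous_lpForm (hp : 0 < p) : Continuous (lpForm p w u) := by
  unfold lpForm dotProduct
  refine continuous_finsetSum _ fun i _ => continuous_const.mul ?_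
  exact Continuous.rpow_const (by fun_prop) fun _ => Or.inr hp.le

lemma lpForm_smul {r : ℝ} (hr : 0 ≤ r) (x : Fin d → ℝ) :
    lpForm p w u (r • x) = r ^ p * lpForm p w u x := by
  unfold lpForm
  rw [Finset.mul_sum]
  refine Finset.sum_congr rfl fun i _ => ?_
  rw [dotProduct_smul, smul_eq_mul, abs_mul, abs_of_nonneg hr, Real.mul_rpow hr (abs_nonneg _)]
  ring

lemma lpForm_zero (hp : 0 < p) : lpForm p w u 0 = 0 := by
  simp [lpForm, Real.zero_rpow hp.ne']

lemma lpForm_sub_le (hp : 0 < p) (hp2 : p ≤ 2) (hw : ∀ i, 0 ≤ w i) (x y : Fin d → ℝ) :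
    lpForm p w u (x - y) ≤ 2 * (lpForm p w u x + lpForm p w u y) := by
  unfold lpForm
  rw [← Finset.sum_add_distrib, Finset.mul_sum]
  refine Finset.sum_le_sum fun i _ => ?_
  have h := abs_add_rpow_le hp hp2 (u i ⬝ᵥ x) (-(u i ⬝ᵥ y))
  rw [abs_neg, ← sub_eq_add_neg, ← dotProduct_sub] at h
  nlinarith [mul_le_mul_of_nonneg_left h (hw i)]

end lpForm

open MeasureTheory Pointwise in
/-- If the exponential moment of `d * g` on the unit ball of `f` is bounded by `2 e ^ (2 d)` times
the volume of the ball, then `g` is bounded by a multiple of `f`. -/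
lemma lpForm_le_of_integral_exp_le {ι κ : Type*} [Fintype ι] [Fintype κ] {d : ℕ} (hd : 0 < d)
    {p₀ p : ℝ} (hp₀ : 0 < p₀) (hp : p₀ ≤ p) (hp2 : p ≤ 2)
    {w : ι → ℝ} {u : ι → Fin d → ℝ} {w' : κ → ℝ} {u' : κ → Fin d → ℝ}
    (hw : ∀ i, 0 ≤ w i) (hw' : ∀ i, 0 ≤ w' i)
    (hcomp : IsCompact {x | lpForm p w u x ≤ 1})
    (hzero : ∀ x, lpForm p w u x = 0 → x = 0)
    (hint : ∫ x in {x | lpForm p w u x ≤ 1}, Real.exp (d * lpForm p w' u' x) ≤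
      2 * Real.exp (2 * d) * volume.real {x | lpForm p w u x ≤ 1}) (x : Fin d → ℝ) :
    lpForm p w' u' x ≤ 16 * (4 + Real.log 4 / p₀) * lpForm p w u x := by
  have hp0 : 0 < p := hp₀.trans_le hp
  set f := lpForm p w u with hf
  set g := lpForm p w' u' with hg
  have hfc : Continuous f := continuous_lpForm hp0
  have hgc : Continuous g := continuous_lpForm hp0
  set D := {x | f x ≤ 1} with hD
  set E := {x | f x ≤ 1 / 4} with hE
  -- `K` makes `e ^ (d K)` equal to `e ^ (4 d) * 4 ^ (d / p₀)`. This beats the factor `2 e ^ (2 d)`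
  -- in the hypothesis and the volume ratio `4 ^ (d / p₀)` of `D` to `E`, leaving `e ^ (2 d) > 4` to
  -- spare.
  set K : ℝ := 4 + Real.log 4 / p₀ with hK
  have hlog4 : 0 < Real.log 4 := Real.log_pos (by norm_num)
  have hDmeas : MeasurableSet D := hcomp.isClosed.measurableSet
  have hDfin : volume D ≠ ⊤ := hcomp.measure_ne_top
  have hDpos : 0 < volume.real D := by
    rw [measureReal_def, ENNReal.toReal_pos_iff]
    refine ⟨?_, hDfin.lt_top⟩
    have ho : IsOpen {x | f x < 1} := isOpen_lt hfc continuous_const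
    have hne : ({x | f x < 1} : Set (Fin d → ℝ)).Nonempty :=
      ⟨0, by simp [hf, lpForm_zero hp0]⟩
    exact (ho.measure_pos volume hne).trans_le (measure_mono fun x hx => show f x ≤ 1 from le_of_lt (show f x < 1 from hx))
  have hED : E ⊆ D := fun y hy => by
    change f y ≤ 1
    have : f y ≤ 1 / 4 := hy
    linarith
  -- the ball `E` is a dilate of the ball `D`
  have hEvol : Real.exp (-(d * (Real.log 4 / p₀))) * volume.real D ≤ volume.real E := by
    set r : ℝ := Real.exp (-(Real.log 4 / p)) with hr
    have hr0 : 0 < r := Real.exp_pos _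
    have hrp : r ^ p = 1 / 4 := by
      rw [hr, ← Real.exp_mul, neg_mul, div_mul_cancel₀ _ hp0.ne', Real.exp_neg,
        Real.exp_log (by norm_num), one_div]
    have hsub : r • D ⊆ E := by
      rintro _ ⟨y, hy, rfl⟩
      change f (r • y) ≤ 1 / 4
      have hy1 : f y ≤ 1 := hy
      rw [hf, lpForm_smul hr0.le, hrp]
      linarith
    have hEfin : volume E ≠ ⊤ := ((measure_mono hED).trans_lt hDfin.lt_top).ne
    have h1 : volume.real (r • D) ≤ volume.real E :=
      ENNReal.toReal_mono hEfin (measure_mono hsub)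
    refine le_trans ?_ h1
    rw [measureReal_def, measureReal_def, Measure.addHaar_smul, ENNReal.toReal_mul,
      ENNReal.toReal_ofReal (abs_nonneg _), abs_of_nonneg (by positivity), Module.finrank_fin_fun,
      hr, ← Real.exp_nat_mul]
    gcongr
    rw [mul_neg, neg_le_neg_iff]
    gcongr
  set Bad := D ∩ {x | K ≤ g x} with hBad
  -- Markov's inequality for `e ^ (d g)` on `D`.
  have hBadvol : Real.exp (d * K) * volume.real Bad ≤ 2 * Real.exp (2 * d) * volume.real D := by
    have hi : IntegrableOn (fun x => Real.exp (d * g x)) D :=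
      ContinuousOn.integrableOn_compact hcomp (by fun_prop)
    have h1 := mul_meas_ge_le_integral_of_nonneg
      (Filter.Eventually.of_forall fun x => (Real.exp_pos (d * g x)).le) hi (Real.exp (d * K))
    have hset : {x | Real.exp (d * K) ≤ Real.exp (d * g x)} = {x | K ≤ g x} := by
      ext y
      have : (0 : ℝ) < d := by exact_mod_cast hd
      simp [Real.exp_le_exp, this]
    rw [hset, measureReal_restrict_apply' hDmeas, Set.inter_comm] at h1
    exact h1.trans hint
  have hlt : 2 * volume.real Bad < volume.real E := by
    refine lt_of_lt_of_le ?_ hEvol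
    have hd1 : (1 : ℝ) ≤ d := by exact_mod_cast hd
    have hexp : Real.exp (d * K) = Real.exp (2 * d) * Real.exp (2 * d) *
        Real.exp (d * (Real.log 4 / p₀)) := by
      rw [← Real.exp_add, ← Real.exp_add]
      congr 1
      rw [hK]
      ring
    have h4 : 4 < Real.exp (2 * d) := by
      have h3 : Real.exp 1 * Real.exp 1 ≤ Real.exp (2 * d) := by
        rw [← Real.exp_add]
        exact Real.exp_le_exp.2 (by linarith)
      have := Real.exp_one_gt_d9
      nlinarith
    rw [hexp] at hBadvol
    rw [Real.exp_neg, lt_inv_mul_iff₀ (Real.exp_pos _)]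
    have he : 0 < Real.exp (2 * (d : ℝ)) := Real.exp_pos _
    have h5 : Real.exp (2 * d) * (Real.exp (d * (Real.log 4 / p₀)) * volume.real Bad) ≤
        2 * volume.real D := by
      refine le_of_mul_le_mul_left ?_ he
      linarith
    nlinarith [Real.exp_pos (d * (Real.log 4 / p₀)), measureReal_nonneg (μ := volume) (s := Bad),
      mul_nonneg (Real.exp_pos (d * (Real.log 4 / p₀))).le
        (measureReal_nonneg (μ := volume) (s := Bad))]
  have hK0 : 0 < K := by positivity
  -- every point of `E` is a difference of two points at which `g` is small
  have hgE : ∀ y ∈ E, g y ≤ 4 * K := by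
    intro y hy
    -- The sets `Bad` and `Bad + y` have total volume below that of `E`, so they cannot cover it.
    obtain ⟨z, hz, hz1, hz2⟩ : ∃ z ∈ E, z ∉ Bad ∧ z - y ∉ Bad := by
      by_contra! hcon
      have hsub : E ⊆ Bad ∪ (fun z => z + -y) ⁻¹' Bad := fun z hz => by
        by_cases h : z ∈ Bad
        · exact Or.inl h
        · exact Or.inr (by simpa [sub_eq_add_neg] using hcon z hz h)
      have hBfin : volume Bad ≠ ⊤ :=
        ((measure_mono Set.inter_subset_left).trans_lt hDfin.lt_top).ne
      have h1 := (measure_mono hsub).trans (measure_union_le (μ := volume) _ _)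
      rw [measure_preimage_add_right] at h1
      have h2 := ENNReal.toReal_mono (ENNReal.add_ne_top.2 ⟨hBfin, hBfin⟩) h1
      rw [ENNReal.toReal_add hBfin hBfin] at h2
      simp only [measureReal_def] at hlt
      linarith
    have hyE : f y ≤ 1 / 4 := hy
    have hzE : f z ≤ 1 / 4 := hz
    have hzy : z - y ∈ D := by
      change f (z - y) ≤ 1
      have : f (z - y) ≤ 2 * (f z + f y) := lpForm_sub_le hp0 hp2 hw z y
      linarith
    have hg1 : g z < K := lt_of_not_ge fun h => hz1 ⟨hED hz, h⟩
    have hg2 : g (z - y) < K := lt_of_not_ge fun h => hz2 ⟨hzy, h⟩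
    have h3 : g (z - (z - y)) ≤ 2 * (g z + g (z - y)) := lpForm_sub_le hp0 hp2 hw' z (z - y)
    rw [sub_sub_cancel] at h3
    linarith
  by_cases hx : f x = 0
  · rw [hzero x hx, hg, lpForm_zero hp0, hf, lpForm_zero hp0, mul_zero]
  · have hfx : 0 < f x := (lpForm_nonneg hw x).lt_of_ne' hx
    -- Rescaling `x` to the boundary value `f = 1 / 4` turns the bound `4 K` into `16 K f x`.
    have hr0 : 0 ≤ (1 / (4 * f x)) ^ (1 / p) := by positivity
    have hrp : ((1 / (4 * f x)) ^ (1 / p)) ^ p = 1 / (4 * f x) := by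
      rw [← Real.rpow_mul (by positivity), one_div_mul_cancel hp0.ne', Real.rpow_one]
    have h1 := hgE ((1 / (4 * f x)) ^ (1 / p) • x) (by
      change f _ ≤ 1 / 4
      rw [hf, lpForm_smul hr0, hrp, ← hf]
      apply le_of_eq
      field_simp)
    rw [hg, lpForm_smul hr0, hrp, ← hg, one_div_mul_eq_div, div_le_iff₀ (by positivity)] at h1
    linarith

/-! ### Sparsifying an isotropic system -/

section

variable {d : ℕ}

lemma sq_dotProduct_le (v x : Fin d → ℝ) : (v ⬝ᵥ x) ^ 2 ≤ (v ⬝ᵥ v) * (x ⬝ᵥ x) := by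
  have h := Finset.sum_mul_sq_le_sq_mul_sq Finset.univ v x
  simpa only [dotProduct, sq] using h

lemma dotProduct_self_nonneg' (x : Fin d → ℝ) : 0 ≤ x ⬝ᵥ x :=
  Finset.sum_nonneg fun _ _ => mul_self_nonneg _

lemma abs_dotProduct_rpow_le {p : ℝ} (hp : 0 < p) {v : Fin d → ℝ} (hv : v ⬝ᵥ v ≤ 1)
    (x : Fin d → ℝ) : |v ⬝ᵥ x| ^ p ≤ (x ⬝ᵥ x) ^ (p / 2) := by
  have h : (v ⬝ᵥ x) ^ 2 ≤ x ⬝ᵥ x := (sq_dotProduct_le (v) x).trans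
    (mul_le_of_le_one_left (dotProduct_self_nonneg' x) hv)
  calc |v ⬝ᵥ x| ^ p = ((v ⬝ᵥ x) ^ 2) ^ (p / 2) := by
        rw [← sq_abs, ← Real.rpow_natCast, ← Real.rpow_mul (abs_nonneg _)]
        congr 1
        push_cast
        ring
    _ ≤ _ := Real.rpow_le_rpow (sq_nonneg _) h (by linarith)

end

section Isotropic

variable {ι : Type*} [Fintype ι] {d : ℕ} {w : ι → ℝ} {u : ι → Fin d → ℝ}

lemma sum_mul_sq_dotProduct_of_isotropic
    (hI : ∀ a b, ∑ i, w i * (u i a * u i b) = if a = b then 1 else 0) (x : Fin d → ℝ) :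
    ∑ i, w i * (u i ⬝ᵥ x) ^ 2 = x ⬝ᵥ x := by
  calc ∑ i, w i * (u i ⬝ᵥ x) ^ 2
      = ∑ a, ∑ b, (∑ i, w i * (u i a * u i b)) * (x a * x b) := by
        simp_rw [dotProduct, sq, Finset.sum_mul_sum, Finset.mul_sum, Finset.sum_mul]
        rw [Finset.sum_comm]
        refine Finset.sum_congr rfl fun a _ => ?_
        rw [Finset.sum_comm]
        exact Finset.sum_congr rfl fun b _ => Finset.sum_congr rfl fun i _ => by ring
    _ = x ⬝ᵥ x := by simp [hI, dotProduct]

lemma sum_weights_of_isotropic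
    (hI : ∀ a b, ∑ i, w i * (u i a * u i b) = if a = b then 1 else 0)
    (hwu : ∀ i, w i * (u i ⬝ᵥ u i) = w i) : ∑ i, w i = d := by
  calc ∑ i, w i = ∑ i, w i * (u i ⬝ᵥ u i) := Finset.sum_congr rfl fun i _ => (hwu i).symm
    _ = ∑ a : Fin d, ∑ i, w i * (u i a * u i a) := by
        simp_rw [dotProduct, Finset.mul_sum]
        rw [Finset.sum_comm]
    _ = d := by simp [hI]

/-- Write `|x| ^ 2 = ∑ w_i |u_i x| ^ 2` and bound `|u_i x| ^ (2 - p)` by `|x| ^ (2 - p)`. This makes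
the unit ball compact and bounds every `|u_i x|` on it by `1`. -/
lemma dotProduct_self_rpow_le_lpForm {p : ℝ} (hp : 0 < p) (hp2 : p ≤ 2) (hw : ∀ i, 0 ≤ w i)
    (hu : ∀ i, u i ⬝ᵥ u i ≤ 1)
    (hI : ∀ a b, ∑ i, w i * (u i a * u i b) = if a = b then 1 else 0) (x : Fin d → ℝ) :
    (x ⬝ᵥ x) ^ (p / 2) ≤ lpForm p w u x := by
  rcases (dotProduct_self_nonneg' x).eq_or_lt with h0 | h0
  · rw [← h0, Real.zero_rpow (by positivity)]
    exact lpForm_nonneg hw x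
  have h1 : x ⬝ᵥ x ≤ (x ⬝ᵥ x) ^ (1 - p / 2) * lpForm p w u x := by
    conv_lhs => rw [← sum_mul_sq_dotProduct_of_isotropic hI x]
    rw [lpForm, Finset.mul_sum]
    refine Finset.sum_le_sum fun i _ => ?_
    have h2 : (u i ⬝ᵥ x) ^ 2 = |u i ⬝ᵥ x| ^ (2 - p) * |u i ⬝ᵥ x| ^ p := by
      rw [← sq_abs, ← Real.rpow_natCast]
      rcases (abs_nonneg (u i ⬝ᵥ x)).eq_or_lt with h | h
      · rw [← h, Real.zero_rpow hp.ne', mul_zero, Real.zero_rpow (by norm_num)]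
      · rw [← Real.rpow_add h]
        norm_num
    have h3 : |u i ⬝ᵥ x| ^ (2 - p) ≤ (x ⬝ᵥ x) ^ (1 - p / 2) := by
      rcases hp2.eq_or_lt with h | h
      · simp [h]
      · have := abs_dotProduct_rpow_le (p := 2 - p) (by linarith) (hu i) x
        rwa [show (2 - p) / 2 = 1 - p / 2 by ring] at this
    rw [h2]
    calc w i * (|u i ⬝ᵥ x| ^ (2 - p) * |u i ⬝ᵥ x| ^ p)
        ≤ w i * ((x ⬝ᵥ x) ^ (1 - p / 2) * |u i ⬝ᵥ x| ^ p) := by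
          have := hw i
          gcongr
      _ = _ := by ring
  have h4 : x ⬝ᵥ x = (x ⬝ᵥ x) ^ (1 - p / 2) * (x ⬝ᵥ x) ^ (p / 2) := by
    rw [← Real.rpow_add h0]
    norm_num
  refine le_of_mul_le_mul_left ?_ (Real.rpow_pos_of_pos h0 (1 - p / 2))
  rwa [← h4]

lemma isCompact_lpForm_le_one {p : ℝ} (hp : 0 < p) (hp2 : p ≤ 2) (hw : ∀ i, 0 ≤ w i)
    (hu : ∀ i, u i ⬝ᵥ u i ≤ 1)
    (hI : ∀ a b, ∑ i, w i * (u i a * u i b) = if a = b then 1 else 0) :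
    IsCompact {x | lpForm p w u x ≤ 1} := by
  refine Metric.isCompact_of_isClosed_isBounded
    (isClosed_le (continuous_lpForm hp) continuous_const)
    ((Metric.isBounded_closedBall (x := 0) (r := 1)).subset fun x hx => ?_)
  have hx1 : lpForm p w u x ≤ 1 := hx
  have h1 : x ⬝ᵥ x ≤ 1 := by
    by_contra! h
    have := Real.one_lt_rpow h (by positivity : 0 < p / 2)
    linarith [dotProduct_self_rpow_le_lpForm hp hp2 hw hu hI x]
  rw [mem_closedBall_zero_iff, pi_norm_le_iff_of_nonneg zero_le_one]
  intro a
  have h2 : x a * x a ≤ x ⬝ᵥ x :=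
    Finset.single_le_sum (f := fun a => x a * x a) (fun b _ => mul_self_nonneg _)
      (Finset.mem_univ a)
  rw [Real.norm_eq_abs]
  exact abs_le_one_iff_mul_self_le_one.2 (h2.trans h1)

/-- The expected squared Frobenius distance between the identity and the Gram matrix of an
independent sample from an isotropic system. -/
lemma sum_prod_mul_frobenius_le (hd : 0 < d) {m : ℕ} (hm : 0 < m)
    (hI : ∀ a b, ∑ i, w i * (u i a * u i b) = if a = b then 1 else 0)
    (hwu : ∀ i, w i * (u i ⬝ᵥ u i) = w i) :
    ∑ s : Fin m → ι, (∏ k, w (s k) / d) * ∑ a, ∑ b,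
      ((d : ℝ) / m * ∑ k, u (s k) a * u (s k) b - if a = b then 1 else 0) ^ 2 ≤
      (d : ℝ) ^ 2 / m := by
  have hd' : (d : ℝ) ≠ 0 := by positivity
  have hm' : (m : ℝ) ≠ 0 := by positivity
  have hπ : ∑ i, w i / d = 1 := by
    rw [← Finset.sum_div, sum_weights_of_isotropic hI hwu, div_self hd']
  set ξ : Fin d → Fin d → ι → ℝ := fun a b i => d * (u i a * u i b) - if a = b then 1 else 0
    with hξ
  have hmean : ∀ a b, ∑ i, w i / d * ξ a b i = 0 := fun a b => by
    calc ∑ i, w i / d * ξ a b i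
        = ∑ i, w i * (u i a * u i b) - (∑ i, w i / d) * if a = b then 1 else 0 := by
          rw [Finset.sum_mul, ← Finset.sum_sub_distrib]
          refine Finset.sum_congr rfl fun i _ => ?_
          simp only [hξ]
          field_simp
      _ = 0 := by rw [hI, hπ, one_mul, sub_self]
  have hentry : ∀ (s : Fin m → ι) a b,
      ((d : ℝ) / m * ∑ k, u (s k) a * u (s k) b - if a = b then 1 else 0) ^ 2 =
        1 / (m : ℝ) ^ 2 * (∑ k, ξ a b (s k)) ^ 2 := by
    intro s a b
    have : ∑ k, ξ a b (s k) =
        d * (∑ k, u (s k) a * u (s k) b) - m * if a = b then 1 else 0 := by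
      simp only [hξ, Finset.sum_sub_distrib, Finset.mul_sum, Finset.sum_const, Finset.card_univ,
        Fintype.card_fin, nsmul_eq_mul]
    rw [this]
    field_simp
  -- A variance is at most the second moment. Summed over `a, b`, the second moments give `d ∑ w_i
  -- |u_i| ^ 4 = d ^ 2`.
  have hsecond : ∀ a b, ∑ i, w i / d * ξ a b i ^ 2 ≤ ∑ i, w i * d * (u i a * u i b) ^ 2 := by
    intro a b
    have h1 : ∑ i, w i / d * ξ a b i ^ 2 = ∑ i, w i * d * (u i a * u i b) ^ 2 -
        2 * (if a = b then 1 else 0) * (∑ i, w i * (u i a * u i b)) +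
        (if a = b then 1 else 0) * ∑ i, w i / d := by
      rw [Finset.mul_sum, Finset.mul_sum, ← Finset.sum_sub_distrib, ← Finset.sum_add_distrib]
      refine Finset.sum_congr rfl fun i _ => ?_
      simp only [hξ]
      split_ifs <;> field_simp <;> ring
    rw [h1, hI, hπ]
    split_ifs <;> linarith
  calc _ = ∑ a, ∑ b, 1 / (m : ℝ) ^ 2 *
          ∑ s : Fin m → ι, (∏ k, w (s k) / d) * (∑ k, ξ a b (s k)) ^ 2 := by
        simp_rw [hentry, Finset.mul_sum]
        rw [Finset.sum_comm]
        refine Finset.sum_congr rfl fun a _ => ?_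
        rw [Finset.sum_comm]
        exact Finset.sum_congr rfl fun b _ => Finset.sum_congr rfl fun s _ => by ring
    _ = 1 / m * ∑ a, ∑ b, ∑ i, w i / d * ξ a b i ^ 2 := by
        simp_rw [fun a b => sum_prod_mul_sq_sum hπ (hmean a b) (m := m)]
        rw [Finset.mul_sum]
        refine Finset.sum_congr rfl fun a _ => ?_
        rw [Finset.mul_sum]
        refine Finset.sum_congr rfl fun b _ => ?_
        field_simp
    _ ≤ 1 / m * ∑ a, ∑ b, ∑ i, w i * d * (u i a * u i b) ^ 2 := by
        exact mul_le_mul_of_nonneg_left (Finset.sum_le_sum fun a _ =>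
          Finset.sum_le_sum fun b _ => hsecond a b) (by positivity)
    _ = 1 / m * (d * ∑ i, w i * (u i ⬝ᵥ u i) * (u i ⬝ᵥ u i)) := by
        congr 1
        simp_rw [dotProduct, mul_assoc, Finset.sum_mul_sum, Finset.mul_sum]
        conv_rhs => rw [Finset.sum_comm]
        refine Finset.sum_congr rfl fun a _ => ?_
        conv_rhs => rw [Finset.sum_comm]
        exact Finset.sum_congr rfl fun b _ => Finset.sum_congr rfl fun i _ => by ring
    _ = (d : ℝ) ^ 2 / m := by
        simp_rw [hwu]
        rw [sum_weights_of_isotropic hI hwu]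
        ring

/-- By Cauchy–Schwarz the form of the error matrix at `x` is at most its Frobenius norm times `|x| ^
2`, here at most half of `|x| ^ 2`. -/
lemma dotProduct_self_le_of_frobenius_le {m : ℕ} {c : ℝ} {v : Fin m → Fin d → ℝ}
    (h : ∑ a, ∑ b, (c * ∑ k, v k a * v k b - if a = b then 1 else 0) ^ 2 ≤ 1 / 4)
    (x : Fin d → ℝ) : x ⬝ᵥ x ≤ 2 * (c * ∑ k, (v k ⬝ᵥ x) ^ 2) := by
  set Ξ : Fin d → Fin d → ℝ := fun a b => c * ∑ k, v k a * v k b - if a = b then 1 else 0 with hΞ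
  have h1 : c * ∑ k, (v k ⬝ᵥ x) ^ 2 - x ⬝ᵥ x = ∑ q : Fin d × Fin d, Ξ q.1 q.2 * (x q.1 * x q.2) := by
    rw [Fintype.sum_prod_type]
    simp only [hΞ, sub_mul, Finset.sum_sub_distrib, ite_mul, one_mul, zero_mul,
      Finset.sum_ite_eq, Finset.mem_univ, if_true]
    congr 1
    simp_rw [dotProduct, sq, Finset.sum_mul_sum, Finset.mul_sum, Finset.sum_mul]
    rw [Finset.sum_comm]
    refine Finset.sum_congr rfl fun a _ => ?_
    rw [Finset.sum_comm]
    exact Finset.sum_congr rfl fun b _ => Finset.sum_congr rfl fun k _ => by ring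
  have h2 := Finset.sum_mul_sq_le_sq_mul_sq Finset.univ (fun q : Fin d × Fin d => Ξ q.1 q.2)
    (fun q => x q.1 * x q.2)
  rw [← h1] at h2
  have h3 : ∑ q : Fin d × Fin d, (x q.1 * x q.2) ^ 2 = (x ⬝ᵥ x) ^ 2 := by
    rw [Fintype.sum_prod_type, dotProduct, sq, Finset.sum_mul_sum]
    exact Finset.sum_congr rfl fun a _ => Finset.sum_congr rfl fun b _ => by ring
  rw [h3, Fintype.sum_prod_type] at h2
  have h4 : (c * ∑ k, (v k ⬝ᵥ x) ^ 2 - x ⬝ᵥ x) ^ 2 ≤ (1 / 2 * (x ⬝ᵥ x)) ^ 2 := by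
    calc _ ≤ _ := h2
      _ ≤ 1 / 4 * (x ⬝ᵥ x) ^ 2 := mul_le_mul_of_nonneg_right h (sq_nonneg _)
      _ = _ := by ring
  have h5 := abs_le_of_sq_le_sq h4 (by linarith [dotProduct_self_nonneg' x])
  linarith [(abs_le.1 h5).1]

open MeasureTheory in
/-- The expected exponential moment of the quasi-norm of a sample. -/
lemma sum_prod_mul_integral_exp_le (hd : 0 < d) {m : ℕ} (hm : d ^ 2 ≤ m)
    {p : ℝ} (hp : 0 < p) (hp2 : p ≤ 2)
    (hw : ∀ i, 0 ≤ w i) (hu : ∀ i, u i ⬝ᵥ u i ≤ 1) (hwu : ∀ i, w i * (u i ⬝ᵥ u i) = w i)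
    (hI : ∀ a b, ∑ i, w i * (u i a * u i b) = if a = b then 1 else 0) :
    ∑ s : Fin m → ι, (∏ k, w (s k) / d) * ∫ x in {x | lpForm p w u x ≤ 1},
      Real.exp (d * lpForm p (fun _ : Fin m => (d : ℝ) / m) (fun k => u (s k)) x) ≤
      Real.exp (2 * d) * volume.real {x | lpForm p w u x ≤ 1} := by
  have hcomp := isCompact_lpForm_le_one hp hp2 hw hu hI
  set D := {x | lpForm p w u x ≤ 1} with hD
  have hd' : (d : ℝ) ≠ 0 := by positivity
  have hm0 : 0 < m := lt_of_lt_of_le (by positivity) hm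
  have hm' : (m : ℝ) ≠ 0 := by positivity
  have hπ : ∑ i, w i / d = 1 := by
    rw [← Finset.sum_div, sum_weights_of_isotropic hI hwu, div_self hd']
  have hcont : ∀ s : Fin m → ι, Continuous fun x =>
      (∏ k, w (s k) / d) *
        Real.exp (d * lpForm p (fun _ : Fin m => (d : ℝ) / m) (fun k => u (s k)) x) := fun s =>
    continuous_const.mul (Real.continuous_exp.comp
      (continuous_const.mul (continuous_lpForm hp)))
  simp_rw [← integral_const_mul]
  rw [← integral_finsetSum _ fun s _ => (hcont s).continuousOn.integrableOn_compact hcomp]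
  have hbound : ∀ x ∈ D, ∑ s : Fin m → ι, (∏ k, w (s k) / d) *
      Real.exp (d * lpForm p (fun _ : Fin m => (d : ℝ) / m) (fun k => u (s k)) x) ≤
      Real.exp (2 * d) := by
    intro x hx
    have hx1 : lpForm p w u x ≤ 1 := hx
    set θ : ℝ := (d : ℝ) ^ 2 / m with hθ
    have hθ0 : 0 ≤ θ := by positivity
    have hθ1 : θ ≤ 1 := by
      rw [hθ, div_le_one (by positivity)]
      exact_mod_cast hm
    have hone : ∀ i, |u i ⬝ᵥ x| ^ p ≤ 1 := fun i => by
      refine (abs_dotProduct_rpow_le hp (hu i) x).trans ?_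
      exact (dotProduct_self_rpow_le_lpForm hp hp2 hw hu hI x).trans hx1
    have hprod : ∀ s : Fin m → ι, (∏ k, w (s k) / d) *
        Real.exp (d * lpForm p (fun _ : Fin m => (d : ℝ) / m) (fun k => u (s k)) x) =
        ∏ k, w (s k) / d * Real.exp (θ * |u (s k) ⬝ᵥ x| ^ p) := fun s => by
      rw [Finset.prod_mul_distrib, ← Real.exp_sum, lpForm, Finset.mul_sum]
      congr 3
      refine funext fun k => ?_
      rw [hθ]
      ring
    simp_rw [hprod]
    rw [sum_prod_apply fun _ i => w i / d * Real.exp (θ * |u i ⬝ᵥ x| ^ p), Finset.prod_const,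
      Finset.card_univ, Fintype.card_fin]
    -- On `D` the exponent is at most `1`, so `e ^ t ≤ 1 + 2 t` applies to each independent factor;
    -- the product of the `m` factors is then at most `e ^ (2 d)` at every point of `D`.
    have hsum : ∑ i, w i / d * Real.exp (θ * |u i ⬝ᵥ x| ^ p) ≤ Real.exp (2 * d / m) := by
      calc ∑ i, w i / d * Real.exp (θ * |u i ⬝ᵥ x| ^ p)
          ≤ ∑ i, w i / d * (1 + 2 * (θ * |u i ⬝ᵥ x| ^ p)) := by
            refine Finset.sum_le_sum fun i _ => ?_
            have h0 : 0 ≤ θ * |u i ⬝ᵥ x| ^ p := by positivity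
            have h1 : θ * |u i ⬝ᵥ x| ^ p ≤ 1 := mul_le_one₀ hθ1 (by positivity) (hone i)
            have h2 := Real.abs_exp_sub_one_le (x := θ * |u i ⬝ᵥ x| ^ p)
              (by rwa [abs_of_nonneg h0])
            rw [abs_of_nonneg h0] at h2
            have := hw i
            gcongr
            linarith [(abs_le.1 h2).2]
        _ = 1 + 2 * d / m * lpForm p w u x := by
            conv_rhs => rw [← hπ]
            rw [lpForm, Finset.mul_sum, ← Finset.sum_add_distrib]
            refine Finset.sum_congr rfl fun i _ => ?_
            rw [hθ]
            field_simp
        _ ≤ 2 * d / m + 1 := by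
            have : 0 ≤ 2 * (d : ℝ) / m := by positivity
            nlinarith
        _ ≤ Real.exp (2 * d / m) := Real.add_one_le_exp _
    calc _ ≤ Real.exp (2 * d / m) ^ m := by
          refine pow_le_pow_left₀ (Finset.sum_nonneg fun i _ => ?_) hsum m
          have := hw i
          positivity
      _ = Real.exp (2 * d) := by
          rw [← Real.exp_nat_mul]
          congr 1
          field_simp
  calc _ ≤ ∫ _ in D, Real.exp (2 * d) := by
        refine setIntegral_mono_on ?_ ?_ hcomp.isClosed.measurableSet hbound
        · exact (continuous_finsetSum _ fun s _ => hcont s).continuousOn.integrableOn_compact hcomp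
        · exact continuous_const.continuousOn.integrableOn_compact hcomp
    _ = _ := by
        rw [setIntegral_const, smul_eq_mul, mul_comm]

/-- An isotropic system can be sparsified to any number `m ≥ 8 d ^ 2` of vectors with equal
weights, so that the quadratic form decreases by at most a factor `2` and the `p`-th power of the
`ℓ_p` quasi-norm increases at most by a constant factor. -/
theorem exists_sparsification (hd : 0 < d) {m : ℕ} (hm : 8 * d ^ 2 ≤ m)
    {p₀ p : ℝ} (hp₀ : 0 < p₀) (hp : p₀ ≤ p) (hp2 : p ≤ 2)
    (hw : ∀ i, 0 ≤ w i) (hu : ∀ i, u i ⬝ᵥ u i ≤ 1) (hwu : ∀ i, w i * (u i ⬝ᵥ u i) = w i)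
    (hI : ∀ a b, ∑ i, w i * (u i a * u i b) = if a = b then 1 else 0) :
    ∃ s : Fin m → ι, (∀ x, x ⬝ᵥ x ≤ 2 * ((d : ℝ) / m * ∑ k, (u (s k) ⬝ᵥ x) ^ 2)) ∧
      ∀ x, (d : ℝ) / m * ∑ k, |u (s k) ⬝ᵥ x| ^ p ≤
        16 * (4 + Real.log 4 / p₀) * ∑ i, w i * |u i ⬝ᵥ x| ^ p := by
  have hp0 : 0 < p := hp₀.trans_le hp
  have hm0 : 0 < m := lt_of_lt_of_le (by positivity) hm
  have hd' : (0 : ℝ) < d := by exact_mod_cast hd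
  have hm' : (0 : ℝ) < m := by exact_mod_cast hm0
  have hcomp := isCompact_lpForm_le_one hp0 hp2 hw hu hI
  set D := {x | lpForm p w u x ≤ 1} with hD
  set V := MeasureTheory.volume.real D with hV
  set Fr : (Fin m → ι) → ℝ := fun s => ∑ a, ∑ b,
    ((d : ℝ) / m * ∑ k, u (s k) a * u (s k) b - if a = b then 1 else 0) ^ 2 with hFr
  set J : (Fin m → ι) → ℝ := fun s => ∫ x in D,
    Real.exp (d * lpForm p (fun _ : Fin m => (d : ℝ) / m) (fun k => u (s k)) x) with hJ
  have hFrobenius : ∑ s, (∏ k, w (s k) / d) * Fr s ≤ (d : ℝ) ^ 2 / m :=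
    sum_prod_mul_frobenius_le hd hm0 hI hwu
  have hIntegral : ∑ s, (∏ k, w (s k) / d) * J s ≤ Real.exp (2 * d) * V :=
    sum_prod_mul_integral_exp_le hd (by nlinarith) hp0 hp2 hw hu hwu hI
  have hπ : ∑ i, w i / d = 1 := by
    rw [← Finset.sum_div, sum_weights_of_isotropic hI hwu, div_self hd'.ne']
  have hFr0 : ∀ s, 0 ≤ Fr s := fun s =>
    Finset.sum_nonneg fun a _ => Finset.sum_nonneg fun b _ => sq_nonneg _
  have hJ0 : ∀ s, 0 ≤ J s := fun s =>
    MeasureTheory.integral_nonneg fun x => (Real.exp_pos _).le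
  have hVpos : 0 < Real.exp (2 * d) * V := by
    have : 0 < V := by
      rw [hV, MeasureTheory.measureReal_def, ENNReal.toReal_pos_iff]
      refine ⟨?_, hcomp.measure_lt_top⟩
      have ho : IsOpen {x | lpForm p w u x < 1} :=
        isOpen_lt (continuous_lpForm hp0) continuous_const
      have hne : ({x | lpForm p w u x < 1} : Set (Fin d → ℝ)).Nonempty :=
        ⟨0, by simp [lpForm_zero hp0]⟩
      exact (ho.measure_pos MeasureTheory.volume hne).trans_le
        (MeasureTheory.measure_mono fun x hx =>
          show lpForm p w u x ≤ 1 from le_of_lt (show lpForm p w u x < 1 from hx))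
    positivity
  -- The two requirements are combined in one functional of mean at most `4 / 8 + 1 / 2 = 1`. A
  -- sample with value at most `1` has squared Frobenius error at most `1 / 4` and exponential
  -- integral at most twice its bound.
  obtain ⟨s, hs⟩ := exists_le_of_sum_mul_le (P := fun s : Fin m → ι => ∏ k, w (s k) / d)
    (F := fun s => 4 * Fr s + J s / (2 * (Real.exp (2 * d) * V))) (b := 1)
    (fun s => Finset.prod_nonneg fun k _ => div_nonneg (hw _) hd'.le)
    (sum_prod_eq_one hπ m) (by
      have h1 : ∑ s : Fin m → ι, (∏ k, w (s k) / d) *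
          (4 * Fr s + J s / (2 * (Real.exp (2 * d) * V))) =
          4 * (∑ s, (∏ k, w (s k) / d) * Fr s) +
          (∑ s, (∏ k, w (s k) / d) * J s) / (2 * (Real.exp (2 * d) * V)) := by
        rw [Finset.mul_sum, Finset.sum_div, ← Finset.sum_add_distrib]
        exact Finset.sum_congr rfl fun s _ => by ring
      have h2 : (d : ℝ) ^ 2 / m ≤ 1 / 8 := by
        rw [div_le_div_iff₀ hm' (by norm_num)]
        have : (8 * (d : ℝ) ^ 2) ≤ m := by exact_mod_cast hm
        linarith
      have h3 : (∑ s, (∏ k, w (s k) / d) * J s) / (2 * (Real.exp (2 * d) * V)) ≤ 1 / 2 := by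
        rw [div_le_div_iff₀ (by positivity) (by norm_num)]
        linarith
      rw [h1]
      linarith)
  have hJs : 0 ≤ J s / (2 * (Real.exp (2 * d) * V)) := div_nonneg (hJ0 s) (by positivity)
  refine ⟨s, dotProduct_self_le_of_frobenius_le (v := fun k => u (s k)) ?_, fun x => ?_⟩
  · change Fr s ≤ 1 / 4
    linarith
  · have hle : J s ≤ 2 * Real.exp (2 * d) * V := by
      have : J s / (2 * (Real.exp (2 * d) * V)) ≤ 1 := by linarith [hFr0 s]
      rw [div_le_one (by positivity)] at this
      linarith
    have h := lpForm_le_of_integral_exp_le hd hp₀ hp hp2 (w' := fun _ : Fin m => (d : ℝ) / m)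
      (u' := fun k => u (s k)) hw (fun _ => by positivity) hcomp (fun y hy => ?_) hle x
    · simpa only [lpForm, Finset.mul_sum] using h
    · by_contra hy0
      have h1 : 0 < y ⬝ᵥ y := (dotProduct_self_nonneg' y).lt_of_ne' fun h =>
        hy0 (dotProduct_self_eq_zero.1 h)
      have h2 := dotProduct_self_rpow_le_lpForm hp0 hp2 hw hu hI y
      have := Real.rpow_pos_of_pos h1 (p / 2)
      linarith

end Isotropic

/-! ### Sparsifying a matrix according to its Lewis weights -/

open scoped MatrixOrder in
lemma exists_eq_transpose_mul_self {d : ℕ} {M : Matrix (Fin d) (Fin d) ℝ} (hM : M.PosDef) :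
    ∃ L : Matrix (Fin d) (Fin d) ℝ, M = Lᵀ * L ∧ IsUnit L.det := by
  obtain ⟨L, hL⟩ := CStarAlgebra.nonneg_iff_eq_star_mul_self.mp hM.posSemidef.nonneg
  rw [Matrix.star_eq_conjTranspose, Matrix.conjTranspose_eq_transpose_of_trivial] at hL
  refine ⟨L, hL, ?_⟩
  have h : IsUnit M.det := (Matrix.isUnit_iff_isUnit_det _).1 hM.isUnit
  rw [hL, Matrix.det_mul] at h
  exact isUnit_of_mul_isUnit_right h

/-- The rows of `A`, divided by the `p`-th roots of their weights. -/
def normalizedRow {n d : ℕ} (p : ℝ) (A : Matrix (Fin n) (Fin d) ℝ) (w : Fin n → ℝ) (i : Fin n) :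
    Fin d → ℝ :=
  (w i ^ (1 / p))⁻¹ • A i

/-- Factor the Lewis Gram matrix as `Lᵀ L` and change variables by `L`. The Lewis equation makes the
transformed normalized rows unit vectors, and the definition of the Gram matrix makes them isotropic
with weights `w`. -/
theorem IsLewisWeights.exists_sparsification {n d : ℕ} (hd : 0 < d) {m : ℕ} (hm : 8 * d ^ 2 ≤ m)
    {p₀ p : ℝ} (hp₀ : 0 < p₀) (hp : p₀ ≤ p) (hp2 : p < 2)
    {A : Matrix (Fin n) (Fin d) ℝ} {w : Fin n → ℝ} (h : IsLewisWeights p A w) :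
    ∃ s : Fin m → Fin n,
      (∀ z, z ⬝ᵥ (lewisGram p A w *ᵥ z) ≤
        2 * ((d : ℝ) / m * ∑ k, (normalizedRow p A w (s k) ⬝ᵥ z) ^ 2)) ∧
      ∀ z, (d : ℝ) / m * ∑ k, |normalizedRow p A w (s k) ⬝ᵥ z| ^ p ≤
        16 * (4 + Real.log 4 / p₀) * ∑ i, |A i ⬝ᵥ z| ^ p := by
  have hp0 : 0 < p := hp₀.trans_le hp
  obtain ⟨L, hL, hLdet⟩ := exists_eq_transpose_mul_self h.posDef
  set u : Fin n → Fin d → ℝ := fun i => normalizedRow p A w i ᵥ* L⁻¹ with hu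
  have huL : ∀ i z, u i ⬝ᵥ (L *ᵥ z) = normalizedRow p A w i ⬝ᵥ z := fun i z => by
    rw [hu, ← Matrix.dotProduct_mulVec, Matrix.mulVec_mulVec, Matrix.nonsing_inv_mul _ hLdet,
      Matrix.one_mulVec]
  -- A row of weight zero is normalized by `0⁻¹ = 0`, hence the zero vector in that case.
  have huu : ∀ i, u i ⬝ᵥ u i = if w i = 0 then 0 else 1 := fun i => by
    have h1 : u i ⬝ᵥ u i = ((w i ^ (1 / p))⁻¹) ^ 2 * w i ^ (2 / p) := by
      have h2 : u i ⬝ᵥ u i =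
          normalizedRow p A w i ⬝ᵥ (L⁻¹ *ᵥ ((L⁻¹)ᵀ *ᵥ normalizedRow p A w i)) := by
        rw [hu, Matrix.mulVec_transpose, Matrix.dotProduct_mulVec]
      rw [h2, Matrix.mulVec_mulVec,
        Matrix.transpose_nonsing_inv, ← Matrix.mul_inv_rev, ← hL, ← h.eq_rpow i, normalizedRow,
        smul_dotProduct, Matrix.mulVec_smul, dotProduct_smul]
      simp only [smul_eq_mul]
      ring
    rw [h1]
    split_ifs with h0
    · have : (1 / p : ℝ) ≠ 0 := by positivity
      rw [h0, Real.zero_rpow this]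
      simp
    · have hw : 0 < w i := (h.nonneg i).lt_of_ne' h0
      have : w i ^ (2 / p) = (w i ^ (1 / p)) ^ 2 := by
        rw [← Real.rpow_natCast, ← Real.rpow_mul hw.le]
        congr 1
        push_cast
        ring
      rw [this, ← mul_pow, inv_mul_cancel₀ (by positivity), one_pow]
  have hexp : 1 - 2 / p ≠ 0 := by
    have : 1 < 2 / p := by rwa [lt_div_iff₀ hp0, one_mul]
    linarith
  have hI : ∀ a b, ∑ i, w i * (u i a * u i b) = if a = b then 1 else 0 := by
    intro a b
    have h1 : (L⁻¹)ᵀ * lewisGram p A w * L⁻¹ = 1 := by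
      rw [hL, Matrix.mul_assoc, Matrix.mul_assoc, Matrix.mul_nonsing_inv _ hLdet, Matrix.mul_one,
        ← Matrix.transpose_mul, Matrix.mul_nonsing_inv _ hLdet, Matrix.transpose_one]
    have h2 : (L⁻¹)ᵀ * lewisGram p A w * L⁻¹ =
        (A * L⁻¹)ᵀ * Matrix.diagonal (fun i => w i ^ (1 - 2 / p)) * (A * L⁻¹) := by
      simp only [lewisGram, Matrix.transpose_mul, Matrix.mul_assoc]
    have h3 : (1 : Matrix (Fin d) (Fin d) ℝ) a b = if a = b then 1 else 0 := Matrix.one_apply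
    rw [← h3, ← h1, h2, Matrix.mul_apply]
    refine Finset.sum_congr rfl fun i _ => ?_
    have hui : ∀ a, u i a = (w i ^ (1 / p))⁻¹ * (A * L⁻¹) i a := fun a => by
      simp only [hu, normalizedRow, Matrix.smul_vecMul, Pi.smul_apply, smul_eq_mul]
      rfl
    rw [Matrix.mul_diagonal, Matrix.transpose_apply, hui, hui]
    have hwi : w i * ((w i ^ (1 / p))⁻¹ * (w i ^ (1 / p))⁻¹) = w i ^ (1 - 2 / p) := by
      rcases (h.nonneg i).eq_or_lt with h0 | h0
      · rw [← h0, Real.zero_rpow hexp, zero_mul]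
      · rw [← Real.rpow_neg h0.le, ← Real.rpow_add h0]
        nth_rewrite 1 [← Real.rpow_one (w i)]
        rw [← Real.rpow_add h0]
        congr 1
        ring
    rw [← hwi]
    ring
  obtain ⟨s, hs1, hs2⟩ := LewisSampling.exists_sparsification hd hm hp₀ hp hp2.le h.nonneg
    (u := u) (fun i => by rw [huu]; split_ifs <;> norm_num)
    (fun i => by rw [huu]; split_ifs with h0 <;> simp [h0]) hI
  refine ⟨s, fun z => ?_, fun z => ?_⟩
  · have h1 := hs1 (L *ᵥ z)
    simp_rw [huL] at h1
    rw [hL, ← Matrix.mulVec_mulVec, Matrix.dotProduct_mulVec, Matrix.vecMul_transpose]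
    exact h1
  · have h1 := hs2 (L *ᵥ z)
    simp_rw [huL] at h1
    refine h1.trans ?_
    have hlog4 : 0 < Real.log 4 := Real.log_pos (by norm_num)
    refine mul_le_mul_of_nonneg_left (Finset.sum_le_sum fun i _ => ?_) (by positivity)
    rw [normalizedRow, smul_dotProduct, smul_eq_mul, abs_mul,
      Real.mul_rpow (abs_nonneg _) (abs_nonneg _), ← mul_assoc]
    refine mul_le_of_le_one_left (by positivity) ?_
    rcases (h.nonneg i).eq_or_lt with h0 | h0
    · rw [← h0, zero_mul]
      exact zero_le_one
    · rw [abs_of_pos (by positivity), Real.inv_rpow (by positivity), ← Real.rpow_mul h0.le,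
        one_div_mul_cancel hp0.ne', Real.rpow_one, mul_inv_cancel₀ h0.ne']

/-! ### Symmetrization -/

lemma add_rpow_le_two_rpow_mul {l a b : ℝ} (hl : 1 ≤ l) (ha : 0 ≤ a) (hb : 0 ≤ b) :
    (a + b) ^ l ≤ 2 ^ l / 2 * (a ^ l + b ^ l) := by
  have h := NNReal.rpow_add_le_mul_rpow_add_rpow ⟨a, ha⟩ ⟨b, hb⟩ hl
  rw [← NNReal.coe_le_coe] at h
  push_cast at h
  rw [Real.rpow_sub_one two_ne_zero] at h
  exact h

section Symmetrization

variable {E : Type*} [NormedAddCommGroup E]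

lemma norm_sub_rpow_le {l : ℝ} (hl : 1 ≤ l) (a b : E) :
    ‖a - b‖ ^ l ≤ 2 ^ l / 2 * (‖a‖ ^ l + ‖b‖ ^ l) :=
  (Real.rpow_le_rpow (norm_nonneg _) (norm_sub_le a b) (by linarith)).trans
    (add_rpow_le_two_rpow_mul hl (norm_nonneg _) (norm_nonneg _))

variable [NormedSpace ℝ E]

lemma norm_sum_smul_rpow_le {κ : Type*} [Fintype κ] {l : ℝ} (hl : 1 ≤ l) {P : κ → ℝ}
    (hP : ∀ s, 0 ≤ P s) (hP1 : ∑ s, P s = 1) (f : κ → E) :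
    ‖∑ s, P s • f s‖ ^ l ≤ ∑ s, P s * ‖f s‖ ^ l := by
  have h1 : ‖∑ s, P s • f s‖ ≤ ∑ s, P s * ‖f s‖ := by
    refine (norm_sum_le _ _).trans (Finset.sum_le_sum fun s _ => ?_)
    rw [norm_smul, Real.norm_of_nonneg (hP s)]
  exact (Real.rpow_le_rpow (norm_nonneg _) h1 (by linarith)).trans
    (Real.rpow_arith_mean_le_arith_mean_rpow _ _ _ (fun s _ => hP s) hP1
      (fun s _ => norm_nonneg _) hl)

variable {ι : Type*} [Fintype ι]

/-- The two samples are exchangeable: swapping `s k` and `s' k` exactly where `σ k = -1` preserves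
the product weights and flips the sign of the `k`-th difference. -/
lemma sum_sum_norm_sub_rpow_eq {N : ℕ} (π : ι → ℝ) (Y : ι → E) (l : ℝ) (σ : Fin N → ℤˣ) :
    ∑ s : Fin N → ι, ∑ s' : Fin N → ι, (∏ k, π (s k)) * (∏ k, π (s' k)) *
        ‖∑ k, Y (s k) - ∑ k, Y (s' k)‖ ^ l =
      ∑ s : Fin N → ι, ∑ s' : Fin N → ι, (∏ k, π (s k)) * (∏ k, π (s' k)) *
        ‖∑ k, ((σ k : ℤ) : ℝ) • Y (s k) - ∑ k, ((σ k : ℤ) : ℝ) • Y (s' k)‖ ^ l := by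
  have hpairs : ∀ c : Fin N → ℝ,
      ∑ s : Fin N → ι, ∑ s' : Fin N → ι, (∏ k, π (s k)) * (∏ k, π (s' k)) *
        ‖∑ k, c k • Y (s k) - ∑ k, c k • Y (s' k)‖ ^ l =
      ∑ r : Fin N → ι × ι, (∏ k, π (r k).1 * π (r k).2) *
        ‖∑ k, c k • (Y (r k).1 - Y (r k).2)‖ ^ l := fun c => by
    rw [← Fintype.sum_prod_type']
    refine (Fintype.sum_equiv (Equiv.arrowProdEquivProdArrow _ _ _) _ _ fun r => ?_).symm
    simp only [Equiv.arrowProdEquivProdArrow, Equiv.coe_fn_mk, Finset.prod_mul_distrib, smul_sub,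
      Finset.sum_sub_distrib]
  have h1 := hpairs fun _ => 1
  simp only [one_smul] at h1
  rw [h1, hpairs fun k => ((σ k : ℤ) : ℝ)]
  refine Fintype.sum_equiv
    (Equiv.piCongrRight fun k => if σ k = 1 then Equiv.refl _ else Equiv.prodComm ι ι) _ _
    fun r => ?_
  have hk : ∀ k, π (r k).1 * π (r k).2 =
      π ((if σ k = 1 then Equiv.refl _ else Equiv.prodComm ι ι) (r k)).1 *
        π ((if σ k = 1 then Equiv.refl _ else Equiv.prodComm ι ι) (r k)).2 ∧
      Y (r k).1 - Y (r k).2 = ((σ k : ℤ) : ℝ) •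
        (Y ((if σ k = 1 then Equiv.refl _ else Equiv.prodComm ι ι) (r k)).1 -
          Y ((if σ k = 1 then Equiv.refl _ else Equiv.prodComm ι ι) (r k)).2) := fun k => by
    rcases Int.units_eq_one_or (σ k) with h | h
    · simp [h]
    · have hne : (-1 : ℤˣ) ≠ 1 := by decide
      simp [h, hne, mul_comm]
  congr 1
  · exact Finset.prod_congr rfl fun k _ => (hk k).1
  · congr 2
    exact Finset.sum_congr rfl fun k _ => (hk k).2

/-- Symmetrization: the moments of the deviation of a sum of independent samples from its mean are
controlled by those of the Rademacher sums of the samples. -/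
theorem sum_norm_sub_rpow_le_rademacher {N : ℕ} {l : ℝ} (hl : 1 ≤ l) {π : ι → ℝ}
    (hπ : ∀ i, 0 ≤ π i) (hπ1 : ∑ i, π i = 1) (Y : ι → E) {μ : E}
    (hμ : ∑ s : Fin N → ι, (∏ k, π (s k)) • ∑ k, Y (s k) = μ) :
    ∑ s : Fin N → ι, (∏ k, π (s k)) * ‖∑ k, Y (s k) - μ‖ ^ l ≤
      2 ^ l * ∑ s : Fin N → ι, (∏ k, π (s k)) *
        𝔼 σ : Fin N → ℤˣ, ‖∑ k, ((σ k : ℤ) : ℝ) • Y (s k)‖ ^ l := by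
  have hP : ∀ s : Fin N → ι, 0 ≤ ∏ k, π (s k) := fun s => Finset.prod_nonneg fun k _ => hπ _
  have hP1 : ∑ s : Fin N → ι, ∏ k, π (s k) = 1 := sum_prod_eq_one hπ1 N
  have hjensen : ∑ s : Fin N → ι, (∏ k, π (s k)) * ‖∑ k, Y (s k) - μ‖ ^ l ≤
      ∑ s : Fin N → ι, ∑ s' : Fin N → ι, (∏ k, π (s k)) * (∏ k, π (s' k)) *
        ‖∑ k, Y (s k) - ∑ k, Y (s' k)‖ ^ l := by
    refine Finset.sum_le_sum fun s _ => ?_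
    have h1 : ∑ k, Y (s k) - μ =
        ∑ s' : Fin N → ι, (∏ k, π (s' k)) • (∑ k, Y (s k) - ∑ k, Y (s' k)) := by
      simp only [smul_sub, Finset.sum_sub_distrib, ← Finset.sum_smul, hP1, one_smul, hμ]
    rw [h1]
    simp only [mul_assoc]
    rw [← Finset.mul_sum]
    exact mul_le_mul_of_nonneg_left (norm_sum_smul_rpow_le hl hP hP1 _) (hP s)
  have hsign : ∀ σ : Fin N → ℤˣ, ∑ s : Fin N → ι, (∏ k, π (s k)) * ‖∑ k, Y (s k) - μ‖ ^ l ≤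
      2 ^ l * ∑ s : Fin N → ι, (∏ k, π (s k)) * ‖∑ k, ((σ k : ℤ) : ℝ) • Y (s k)‖ ^ l := by
    intro σ
    refine hjensen.trans ?_
    rw [sum_sum_norm_sub_rpow_eq π Y l σ]
    set a : (Fin N → ι) → ℝ := fun s => ‖∑ k, ((σ k : ℤ) : ℝ) • Y (s k)‖ ^ l with ha
    calc _ ≤ ∑ s : Fin N → ι, ∑ s' : Fin N → ι, (∏ k, π (s k)) * (∏ k, π (s' k)) *
          (2 ^ l / 2 * (a s + a s')) := by
          refine Finset.sum_le_sum fun s _ => Finset.sum_le_sum fun s' _ => ?_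
          exact mul_le_mul_of_nonneg_left (norm_sub_rpow_le hl _ _) (mul_nonneg (hP s) (hP s'))
      _ = 2 ^ l / 2 * ((∑ s : Fin N → ι, (∏ k, π (s k)) * a s) * (∑ s : Fin N → ι, ∏ k, π (s k)) +
            (∑ s : Fin N → ι, ∏ k, π (s k)) * ∑ s : Fin N → ι, (∏ k, π (s k)) * a s) := by
          rw [Finset.sum_mul_sum, Finset.sum_mul_sum, ← Finset.sum_add_distrib, Finset.mul_sum]
          refine Finset.sum_congr rfl fun s _ => ?_
          rw [← Finset.sum_add_distrib, Finset.mul_sum]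
          exact Finset.sum_congr rfl fun s' _ => by ring
      _ = _ := by
          rw [hP1]
          ring
  calc _ = 𝔼 _σ : Fin N → ℤˣ, ∑ s : Fin N → ι, (∏ k, π (s k)) * ‖∑ k, Y (s k) - μ‖ ^ l :=
        (Fintype.expect_const _).symm
    _ ≤ 𝔼 σ : Fin N → ℤˣ,
          2 ^ l * ∑ s : Fin N → ι, (∏ k, π (s k)) * ‖∑ k, ((σ k : ℤ) : ℝ) • Y (s k)‖ ^ l :=
        Finset.expect_le_expect fun σ _ => hsign σ
    _ = _ := by
        rw [← Finset.mul_expect, Finset.expect_sum_comm]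
        simp_rw [Finset.mul_expect]

/-- Adding further independent symmetric terms does not decrease the moments of a Rademacher
sum. -/
lemma expect_norm_rpow_le_append {N m : ℕ} {l : ℝ} (hl : 1 ≤ l) (Y : Fin N → E) (T : Fin m → E) :
    𝔼 σ : Fin N → ℤˣ, ‖∑ k, ((σ k : ℤ) : ℝ) • Y k‖ ^ l ≤
      𝔼 ρ : Fin (N + m) → ℤˣ, ‖∑ j, ((ρ j : ℤ) : ℝ) • Fin.append Y T j‖ ^ l := by
  have h1 : 𝔼 ρ : Fin (N + m) → ℤˣ, ‖∑ j, ((ρ j : ℤ) : ℝ) • Fin.append Y T j‖ ^ l =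
      𝔼 σ : Fin N → ℤˣ, 𝔼 τ : Fin m → ℤˣ,
        ‖∑ k, ((σ k : ℤ) : ℝ) • Y k + ∑ j, ((τ j : ℤ) : ℝ) • T j‖ ^ l := by
    rw [← Finset.expect_product', Finset.univ_product_univ]
    refine (Fintype.expect_equiv (Fin.appendEquiv N m) _ _ fun r => ?_).symm
    rw [Fin.sum_univ_add]
    simp [Fin.appendEquiv]
  rw [h1]
  refine Finset.expect_le_expect fun σ _ => ?_
  set a := ∑ k, ((σ k : ℤ) : ℝ) • Y k with ha
  set b : (Fin m → ℤˣ) → E := fun τ => ∑ j, ((τ j : ℤ) : ℝ) • T j with hb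
  have hneg : ∀ τ, b (-τ) = -b τ := fun τ => by simp [hb]
  -- Convexity at the midpoint `a` of `a + b τ` and `a - b τ`; averaging over `τ`, the two terms
  -- have the same mean.
  have h2 : ∀ τ, 2 * ‖a‖ ^ l ≤ ‖a + b τ‖ ^ l + ‖a + b (-τ)‖ ^ l := by
    intro τ
    have h3 : (2 : ℝ) • a = (a + b τ) - -(a + b (-τ)) := by
      rw [hneg, two_smul]
      abel
    have h4 := norm_sub_rpow_le hl (a + b τ) (-(a + b (-τ)))
    rw [← h3, norm_neg, norm_smul, Real.norm_two, Real.mul_rpow zero_le_two (norm_nonneg _)] at h4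
    have h5 : (0 : ℝ) < 2 ^ l / 2 := by positivity
    refine le_of_mul_le_mul_left ?_ h5
    linarith
  have h6 : 𝔼 τ : Fin m → ℤˣ, ‖a + b (-τ)‖ ^ l = 𝔼 τ : Fin m → ℤˣ, ‖a + b τ‖ ^ l :=
    Fintype.expect_equiv (Equiv.neg _) _ _ fun τ => rfl
  have h7 : 𝔼 _τ : Fin m → ℤˣ, 2 * ‖a‖ ^ l ≤
      𝔼 τ : Fin m → ℤˣ, (‖a + b τ‖ ^ l + ‖a + b (-τ)‖ ^ l) :=
    Finset.expect_le_expect fun τ _ => h2 τ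
  rw [Fintype.expect_const, Finset.expect_add_distrib, h6] at h7
  linarith

end Symmetrization

/-! ### Norms, sampling errors and Rademacher maxima -/

lemma lpNorm_rpow {n : ℕ} {p : ℝ} (hp : 0 < p) (v : Fin n → ℝ) :
    lpNorm p v ^ p = ∑ i, |v i| ^ p := by
  have h : 0 ≤ ∑ i, |v i| ^ p := Finset.sum_nonneg fun i _ => by positivity
  rw [lpNorm, ← Real.rpow_mul h, one_div_mul_cancel hp.ne', Real.rpow_one]

lemma sum_eq_one_of_lpNorm_eq_one {n : ℕ} {p : ℝ} (hp : 0 < p) {v : Fin n → ℝ}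
    (h : lpNorm p v = 1) : ∑ i, |v i| ^ p = 1 := by
  rw [← lpNorm_rpow hp, h, Real.one_rpow]

/-- Every vector with nonzero image can be rescaled to have an image of norm one. -/
lemma exists_smul_lpNorm_eq_one {n d : ℕ} {p : ℝ} (hp : 0 < p) (A : Matrix (Fin n) (Fin d) ℝ)
    {x : Fin d → ℝ} (hx : 0 < ∑ i, |(A *ᵥ x) i| ^ p) :
    ∃ r : ℝ, 0 ≤ r ∧ r ^ p = (∑ i, |(A *ᵥ x) i| ^ p)⁻¹ ∧ lpNorm p (A *ᵥ (r • x)) = 1 := by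
  set F := ∑ i, |(A *ᵥ x) i| ^ p with hF
  have hr : ((F⁻¹) ^ (1 / p)) ^ p = F⁻¹ := by
    rw [← Real.rpow_mul (by positivity), one_div_mul_cancel hp.ne', Real.rpow_one]
  refine ⟨(F⁻¹) ^ (1 / p), by positivity, hr, ?_⟩
  have hr0 : 0 ≤ (F⁻¹) ^ (1 / p) := by positivity
  have : ∑ i, |(A *ᵥ ((F⁻¹) ^ (1 / p) • x)) i| ^ p = 1 := by
    simp_rw [Matrix.mulVec_smul, Pi.smul_apply, smul_eq_mul, abs_mul, abs_of_nonneg hr0,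
      Real.mul_rpow hr0 (abs_nonneg _), hr]
    rw [← Finset.mul_sum, ← hF, inv_mul_cancel₀ hx.ne']
  rw [lpNorm, this, Real.one_rpow]

lemma abs_sum_sign_mul_le {n : ℕ} (σ : Fin n → ℤˣ) {t : Fin n → ℝ} (ht : ∀ i, 0 ≤ t i) :
    |∑ i, ((σ i : ℤ) : ℝ) * t i| ≤ ∑ i, t i := by
  refine (Finset.abs_sum_le_sum_abs _ _).trans (Finset.sum_le_sum fun i _ => ?_)
  rcases Int.units_eq_one_or (σ i) with h | h <;> simp [h, abs_of_nonneg (ht i)]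

lemma rademacherMax_nonneg {n d : ℕ} (p : ℝ) (A : Matrix (Fin n) (Fin d) ℝ) (σ : Fin n → ℤˣ) :
    0 ≤ rademacherMax p A σ :=
  Real.iSup_nonneg fun _ => abs_nonneg _

lemma abs_sum_sign_mul_le_rademacherMax {n d : ℕ} {p : ℝ} (hp : 0 < p)
    (A : Matrix (Fin n) (Fin d) ℝ) (σ : Fin n → ℤˣ) {x : Fin d → ℝ} {R : ℝ}
    (hR : ∑ i, |(A *ᵥ x) i| ^ p ≤ R) :
    |∑ i, ((σ i : ℤ) : ℝ) * |(A *ᵥ x) i| ^ p| ≤ R * rademacherMax p A σ := by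
  have hF0 : 0 ≤ ∑ i, |(A *ᵥ x) i| ^ p := Finset.sum_nonneg fun i _ => by positivity
  refine le_trans ?_ (mul_le_mul_of_nonneg_right hR (rademacherMax_nonneg p A σ))
  rcases hF0.eq_or_lt with h | h
  · have := abs_sum_sign_mul_le σ (t := fun i => |(A *ᵥ x) i| ^ p) fun i => by positivity
    rw [← h] at this ⊢
    rwa [zero_mul]
  · obtain ⟨r, hr0, hrp, hr⟩ := exists_smul_lpNorm_eq_one hp A h
    -- Boundedness is needed for the real supremum to dominate its terms; on the unit sphere a
    -- signed sum is at most `1`.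
    have hbdd : BddAbove (Set.range fun x : {x : Fin d → ℝ // lpNorm p (A *ᵥ x) = 1} =>
        |∑ i, ((σ i : ℤ) : ℝ) * |(A *ᵥ x.1) i| ^ p|) := by
      refine ⟨1, ?_⟩
      rintro _ ⟨y, rfl⟩
      exact (abs_sum_sign_mul_le σ fun i => by positivity).trans_eq
        (sum_eq_one_of_lpNorm_eq_one hp y.2)
    have h1 := le_ciSup hbdd ⟨r • x, hr⟩
    simp only [Matrix.mulVec_smul, Pi.smul_apply, smul_eq_mul, abs_mul, abs_of_nonneg hr0,
      Real.mul_rpow hr0 (abs_nonneg _), hrp] at h1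
    have h2 : ∑ i, ((σ i : ℤ) : ℝ) * ((∑ i, |(A *ᵥ x) i| ^ p)⁻¹ * |(A *ᵥ x) i| ^ p) =
        (∑ i, |(A *ᵥ x) i| ^ p)⁻¹ * ∑ i, ((σ i : ℤ) : ℝ) * |(A *ᵥ x) i| ^ p := by
      rw [Finset.mul_sum]
      exact Finset.sum_congr rfl fun i _ => by ring
    rw [h2, abs_mul, abs_of_pos (inv_pos.2 h), inv_mul_le_iff₀ h] at h1
    exact h1

lemma samplingMatrix_mul_apply {n N d : ℕ} (p : ℝ) (q : Fin n → ℝ) (s : Fin N → Fin n)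
    (A : Matrix (Fin n) (Fin d) ℝ) (k : Fin N) :
    (samplingMatrix p q s * A) k = (1 / q (s k) ^ (1 / p)) • A (s k) := by
  ext a
  simp [Matrix.mul_apply, samplingMatrix]

/-- This includes `q (s k) = 0`, where both sides are `0` by the convention for division. -/
lemma abs_samplingMatrix_mulVec_rpow {n N d : ℕ} {p : ℝ} (hp : 0 < p) {q : Fin n → ℝ}
    (hq : ∀ i, 0 ≤ q i) (s : Fin N → Fin n) (A : Matrix (Fin n) (Fin d) ℝ) (x : Fin d → ℝ)
    (k : Fin N) :
    |((samplingMatrix p q s * A) *ᵥ x) k| ^ p = |(A *ᵥ x) (s k)| ^ p / q (s k) := by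
  have h : ((samplingMatrix p q s * A) *ᵥ x) k = (1 / q (s k) ^ (1 / p)) * (A *ᵥ x) (s k) := by
    rw [Matrix.mulVec, samplingMatrix_mul_apply, smul_dotProduct]
    rfl
  have hqk := hq (s k)
  rw [h, abs_mul, abs_of_nonneg (by positivity), Real.mul_rpow (by positivity) (abs_nonneg _),
    Real.div_rpow zero_le_one (by positivity), Real.one_rpow, ← Real.rpow_mul hqk,
    one_div_mul_cancel hp.ne', Real.rpow_one, one_div_mul_eq_div]

lemma IsLewisWeights.row_eq_zero {n d : ℕ} {p : ℝ} (hp : 0 < p) {A : Matrix (Fin n) (Fin d) ℝ}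
    {w : Fin n → ℝ} (h : IsLewisWeights p A w) {i : Fin n} (hi : w i = 0) : A i = 0 := by
  by_contra hA
  have h1 := h.posDef.inv.dotProduct_mulVec_pos hA
  rw [star_trivial, h.eq_rpow i, hi, Real.zero_rpow (by positivity)] at h1
  exact lt_irrefl _ h1

lemma IsLewisWeights.exists_pos {n d : ℕ} {p : ℝ} (hp : 0 < p) (hd : 0 < d)
    {A : Matrix (Fin n) (Fin d) ℝ} {w : Fin n → ℝ} (h : IsLewisWeights p A w) : ∃ i, 0 < w i := by
  by_contra! hcon
  have hA : ∀ i, A i = 0 := fun i => h.row_eq_zero hp (le_antisymm (hcon i) (h.nonneg i))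
  have : Nonempty (Fin d) := ⟨⟨0, hd⟩⟩
  have h1 := (posDef_lewisGram_iff p A w).1 h.posDef (fun _ => 1)
    (fun h0 => one_ne_zero (congrFun h0 ⟨0, hd⟩))
  simp [hA] at h1

/-! ### Appending a sparsification to a sampled matrix -/

/-- The sampled matrix `S A`, to which the rows `v ^ (1 / p) w_i ^ (-1 / p) a_i` for `i` in the
list `t` have been appended. -/
def augmentedMatrix {n N m d : ℕ} (p : ℝ) (A : Matrix (Fin n) (Fin d) ℝ) (w q : Fin n → ℝ) (v : ℝ)
    (s : Fin N → Fin n) (t : Fin m → Fin n) : Matrix (Fin (N + m)) (Fin d) ℝ :=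
  Matrix.of (Fin.append (fun k => (samplingMatrix p q s * A) k)
    (fun j => v ^ (1 / p) • normalizedRow p A w (t j)))

section Augmented

variable {n N m d : ℕ} {p : ℝ} {A : Matrix (Fin n) (Fin d) ℝ} {w q : Fin n → ℝ} {v : ℝ}
  {s : Fin N → Fin n} {t : Fin m → Fin n}

lemma augmentedMatrix_castAdd (k : Fin N) :
    augmentedMatrix p A w q v s t (Fin.castAdd m k) = (samplingMatrix p q s * A) k :=
  Fin.append_left (α := Fin d → ℝ) (fun k => (samplingMatrix p q s * A) k)
    (fun j => v ^ (1 / p) • normalizedRow p A w (t j)) k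

lemma augmentedMatrix_natAdd (j : Fin m) :
    augmentedMatrix p A w q v s t (Fin.natAdd N j) = v ^ (1 / p) • normalizedRow p A w (t j) :=
  Fin.append_right (α := Fin d → ℝ) (fun k => (samplingMatrix p q s * A) k)
    (fun j => v ^ (1 / p) • normalizedRow p A w (t j)) j

lemma abs_augmentedMatrix_castAdd_rpow (hp : 0 < p) (hq : ∀ i, 0 ≤ q i) (x : Fin d → ℝ)
    (k : Fin N) :
    |(augmentedMatrix p A w q v s t *ᵥ x) (Fin.castAdd m k)| ^ p =
      |(A *ᵥ x) (s k)| ^ p / q (s k) := by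
  rw [← abs_samplingMatrix_mulVec_rpow hp hq, Matrix.mulVec, augmentedMatrix_castAdd]
  rfl

lemma abs_augmentedMatrix_natAdd_rpow (hp : 0 < p) (hv : 0 ≤ v) (x : Fin d → ℝ) (j : Fin m) :
    |(augmentedMatrix p A w q v s t *ᵥ x) (Fin.natAdd N j)| ^ p =
      v * |normalizedRow p A w (t j) ⬝ᵥ x| ^ p := by
  rw [Matrix.mulVec, augmentedMatrix_natAdd, smul_dotProduct, smul_eq_mul, abs_mul,
    abs_of_nonneg (by positivity), Real.mul_rpow (by positivity) (abs_nonneg _),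
    ← Real.rpow_mul hv, one_div_mul_cancel hp.ne', Real.rpow_one]

/-- Appending a sparsification to a sample makes all Lewis weights small. -/
theorem exists_isLewisWeights_augmentedMatrix (hp : 0 < p) (hp2 : p < 2)
    (h : IsLewisWeights p A w) (hv : 0 < v) {W : ℝ} (hvW : v ≤ W)
    (hq : ∀ i, 0 ≤ q i) (hwq : ∀ i, w i ≤ W * q i)
    (ht : ∀ z, z ⬝ᵥ (lewisGram p A w *ᵥ z) ≤ v * ∑ k, (normalizedRow p A w (t k) ⬝ᵥ z) ^ 2)
    (s : Fin N → Fin n) :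
    ∃ w', IsLewisWeights p (augmentedMatrix p A w q v s t) w' ∧ ∀ i, w' i ≤ W := by
  have hW : 0 < W := hv.trans_le hvW
  set B := augmentedMatrix p A w q v s t with hB
  -- Trial weights: the row of `S A` drawn from `a_i` has score `(w_i / q_i) ^ (2 / p) ≤ W ^ (2 /
  -- p)` in the Gram matrix of `A`, and an appended row has score at most `v ^ (2 / p)`.
  set y : Fin (N + m) → ℝ := Fin.append (fun _ => W) (fun _ => v) with hy
  have hyl : ∀ k, y (Fin.castAdd m k) = W := fun k => Fin.append_left _ _ k
  have hyr : ∀ j, y (Fin.natAdd N j) = v := fun j => Fin.append_right _ _ j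
  have hypos : ∀ i, 0 < y i := fun i => by
    refine Fin.addCases (fun k => ?_) (fun j => ?_) i
    · rwa [hyl]
    · rwa [hyr]
  have hyW : ∀ i, y i ≤ W := fun i => by
    refine Fin.addCases (fun k => ?_) (fun j => ?_) i
    · rw [hyl]
    · rwa [hyr]
  have hsq : ∀ b : ℝ, 0 ≤ b → (b ^ (1 / p)) ^ 2 = b ^ (2 / p) := fun b hb => by
    rw [← Real.rpow_natCast, ← Real.rpow_mul hb]
    congr 1
    push_cast
    ring
  -- The appended rows alone suffice, since `v ^ (1 - 2 / p) * v ^ (2 / p) = v`.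
  have hform : ∀ z, z ⬝ᵥ (lewisGram p A w *ᵥ z) ≤ z ⬝ᵥ (lewisGram p B y *ᵥ z) := fun z => by
    refine (ht z).trans ?_
    rw [dotProduct_lewisGram_mulVec, Fin.sum_univ_add, Finset.mul_sum]
    have h1 : 0 ≤ ∑ k, y (Fin.castAdd m k) ^ (1 - 2 / p) * (B (Fin.castAdd m k) ⬝ᵥ z) ^ 2 :=
      Finset.sum_nonneg fun k _ => mul_nonneg (Real.rpow_nonneg (hypos _).le _) (sq_nonneg _)
    have h2 : ∀ j, v * (normalizedRow p A w (t j) ⬝ᵥ z) ^ 2 =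
        y (Fin.natAdd N j) ^ (1 - 2 / p) * (B (Fin.natAdd N j) ⬝ᵥ z) ^ 2 := fun j => by
      rw [hyr, hB, augmentedMatrix_natAdd, smul_dotProduct, smul_eq_mul, mul_pow, hsq v hv.le,
        ← mul_assoc, ← Real.rpow_add hv]
      norm_num
    rw [Finset.sum_congr rfl fun j _ => h2 j]
    linarith
  have hGA := h.posDef
  have hGB : (lewisGram p B y).PosDef := by
    refine Matrix.PosDef.of_dotProduct_mulVec_pos (isHermitian_lewisGram p B y) fun z hz => ?_
    have := hGA.dotProduct_mulVec_pos hz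
    rw [star_trivial] at this ⊢
    exact this.trans_le (hform z)
  have hrow : ∀ x, x ⬝ᵥ ((lewisGram p B y)⁻¹ *ᵥ x) ≤ x ⬝ᵥ ((lewisGram p A w)⁻¹ *ᵥ x) :=
    fun x => by
      have := dotProduct_inv_mulVec_le hGA hGB one_pos (fun z => by rw [one_mul]; exact hform z) x
      rwa [inv_one, one_mul] at this
  have hscale : ∀ (c : ℝ) i, (c • A i) ⬝ᵥ ((lewisGram p A w)⁻¹ *ᵥ (c • A i)) =
      c ^ 2 * w i ^ (2 / p) := fun c i => by
    rw [smul_dotProduct, Matrix.mulVec_smul, dotProduct_smul, h.eq_rpow i]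
    simp only [smul_eq_mul]
    ring
  have hexp : 0 < 2 / p := by positivity
  obtain ⟨w', hw', hle⟩ := exists_isLewisWeights_le hp hp2 hypos hGB fun i => by
    refine (hrow _).trans ?_
    refine Fin.addCases (fun k => ?_) (fun j => ?_) i
    · rw [hyl, hB, augmentedMatrix_castAdd, samplingMatrix_mul_apply, hscale, div_pow, one_pow,
        hsq _ (hq _), one_div_mul_eq_div, ← Real.div_rpow (h.nonneg _) (hq _)]
      refine Real.rpow_le_rpow (div_nonneg (h.nonneg _) (hq _)) ?_ hexp.le
      exact div_le_of_le_mul₀ (hq _) hW.le (hwq _)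
    · rw [hyr, hB, augmentedMatrix_natAdd, normalizedRow, smul_smul, hscale, mul_pow, inv_pow,
        hsq v hv.le, hsq _ (h.nonneg _), mul_assoc]
      refine mul_le_of_le_one_right (by positivity) ?_
      exact inv_mul_le_one
  exact ⟨w', hw', fun i => (hle i).trans (hyW i)⟩

end Augmented

/-! ### Moments of the sampling error -/

/-- A bounded real function, as an element of `ℓ^∞`. -/
def boundedFunction {X : Type*} (f : X → ℝ) (h : ∃ C, ∀ x, |f x| ≤ C) : lp (fun _ : X => ℝ) ⊤ :=
  ⟨f, memℓp_infty (by
    obtain ⟨C, hC⟩ := h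
    exact ⟨C, by rintro _ ⟨x, rfl⟩; exact hC x⟩)⟩

lemma sum_smul_apply {X κ : Type*} [Fintype κ] (c : κ → ℝ) (f : κ → lp (fun _ : X => ℝ) ⊤)
    (x : X) : (∑ k, c k • f k : lp (fun _ : X => ℝ) ⊤) x = ∑ k, c k * f k x := by
  rw [lp.coeFn_sum, Finset.sum_apply]
  rfl

lemma sum_apply {X κ : Type*} [Fintype κ] (f : κ → lp (fun _ : X => ℝ) ⊤)
    (x : X) : (∑ k, f k : lp (fun _ : X => ℝ) ⊤) x = ∑ k, f k x := by
  rw [lp.coeFn_sum, Finset.sum_apply]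

lemma sampleProb_eq {n N : ℕ} (q : Fin n → ℝ) (s : Fin N → Fin n) :
    sampleProb q s = ∏ k, q (s k) / N := rfl

lemma samplingError_nonneg {n N d : ℕ} (p : ℝ) (A : Matrix (Fin n) (Fin d) ℝ)
    (S : Matrix (Fin N) (Fin n) ℝ) : 0 ≤ samplingError p A S :=
  Real.iSup_nonneg fun _ => abs_nonneg _

section Moments

variable {n N d : ℕ} {p : ℝ} {A : Matrix (Fin n) (Fin d) ℝ} {q : Fin n → ℝ}

lemma abs_mulVec_rpow_le_one (hp : 0 < p) {x : Fin d → ℝ} (hx : lpNorm p (A *ᵥ x) = 1)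
    (i : Fin n) : |(A *ᵥ x) i| ^ p ≤ 1 := by
  rw [← sum_eq_one_of_lpNorm_eq_one hp hx]
  exact Finset.single_le_sum (f := fun i => |(A *ᵥ x) i| ^ p) (fun j _ => by positivity)
    (Finset.mem_univ i)

/-- The contribution `x ↦ |a_iᵀ x| ^ p / q_i` of the `i`-th row to a sample, as a function on the
unit sphere of `A`. -/
def rowFunction (hp : 0 < p) (A : Matrix (Fin n) (Fin d) ℝ) {q : Fin n → ℝ} (hq : ∀ i, 0 ≤ q i)
    (i : Fin n) : lp (fun _ : {x : Fin d → ℝ // lpNorm p (A *ᵥ x) = 1} => ℝ) ⊤ :=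
  boundedFunction (fun x => |(A *ᵥ x.1) i| ^ p / q i) ⟨1 / q i, fun x => by
    have hqi := hq i
    rw [abs_of_nonneg (by positivity)]
    exact div_le_div_of_nonneg_right (abs_mulVec_rpow_le_one hp x.2 i) hqi⟩

/-- The constant function `1` on the unit sphere of `A`. -/
def oneFunction (p : ℝ) (A : Matrix (Fin n) (Fin d) ℝ) :
    lp (fun _ : {x : Fin d → ℝ // lpNorm p (A *ᵥ x) = 1} => ℝ) ⊤ :=
  boundedFunction (fun _ => 1) ⟨1, fun _ => by simp⟩

lemma lpNorm_sampling_rpow (hp : 0 < p) (hq : ∀ i, 0 ≤ q i) (s : Fin N → Fin n)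
    (x : Fin d → ℝ) :
    lpNorm p ((samplingMatrix p q s * A) *ᵥ x) ^ p = ∑ k, |(A *ᵥ x) (s k)| ^ p / q (s k) := by
  rw [lpNorm_rpow hp]
  exact Finset.sum_congr rfl fun k _ => abs_samplingMatrix_mulVec_rpow hp hq s A x k

lemma sub_oneFunction_apply (hp : 0 < p) (hq : ∀ i, 0 ≤ q i) (s : Fin N → Fin n)
    (x : {x : Fin d → ℝ // lpNorm p (A *ᵥ x) = 1}) :
    (∑ k, rowFunction hp A hq (s k) - oneFunction p A :
      lp (fun _ : {x : Fin d → ℝ // lpNorm p (A *ᵥ x) = 1} => ℝ) ⊤) x =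
      lpNorm p ((samplingMatrix p q s * A) *ᵥ x.1) ^ p - 1 := by
  rw [lp.coeFn_sub, Pi.sub_apply, sum_apply, lpNorm_sampling_rpow hp hq]
  rfl

/-- The maximum over the sphere becomes an `ℓ^∞` norm, so that symmetrization in a normed space
applies. -/
lemma samplingError_eq_norm (hp : 0 < p) (hq : ∀ i, 0 ≤ q i) (s : Fin N → Fin n) :
    samplingError p A (samplingMatrix p q s) =
      ‖∑ k, rowFunction hp A hq (s k) - oneFunction p A‖ := by
  rw [lp.norm_eq_ciSup, samplingError]
  refine iSup_congr fun x => ?_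
  rw [sub_oneFunction_apply, Real.norm_eq_abs]

lemma abs_lpNorm_rpow_sub_one_le_samplingError (hp : 0 < p) (hq : ∀ i, 0 ≤ q i)
    (s : Fin N → Fin n) {x : Fin d → ℝ} (hx : lpNorm p (A *ᵥ x) = 1) :
    |lpNorm p ((samplingMatrix p q s * A) *ᵥ x) ^ p - 1| ≤
      samplingError p A (samplingMatrix p q s) := by
  rw [samplingError_eq_norm hp hq, ← Real.norm_eq_abs,
    ← sub_oneFunction_apply hp hq s ⟨x, hx⟩]
  exact lp.norm_apply_le_norm ENNReal.top_ne_zero _ _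

lemma sum_div_eq_one (hN : 0 < N) (hqN : ∑ i, q i = N) : ∑ i, q i / N = 1 := by
  rw [← Finset.sum_div, hqN, div_self (by positivity)]

lemma sum_sampleProb_smul_rowFunction (hp : 0 < p) (hq : ∀ i, 0 ≤ q i) (hN : 0 < N)
    (hqN : ∑ i, q i = N) (hA : ∀ i, q i = 0 → A i = 0) :
    ∑ s : Fin N → Fin n, (∏ k, q (s k) / N) • ∑ k, rowFunction hp A hq (s k) =
      oneFunction p A := by
  have hN' : (N : ℝ) ≠ 0 := by positivity
  ext x
  rw [sum_smul_apply]
  simp_rw [sum_apply, Finset.mul_sum]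
  rw [Finset.sum_comm]
  simp_rw [fun k => sum_prod_mul_apply (m := N) (sum_div_eq_one hN hqN)
    (fun i => rowFunction hp A hq i x) k]
  rw [Finset.sum_const, Finset.card_univ, Fintype.card_fin, nsmul_eq_mul, Finset.mul_sum]
  change _ = (1 : ℝ)
  refine Eq.trans ?_ (sum_eq_one_of_lpNorm_eq_one hp x.2)
  refine Finset.sum_congr rfl fun i _ => ?_
  change N * (q i / N * (|(A *ᵥ x.1) i| ^ p / q i)) = _
  -- An index that is never drawn contributes nothing to the mean, which is correct only because its
  -- row vanishes.
  by_cases hqi : q i = 0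
  · have : (A *ᵥ x.1) i = 0 := by rw [Matrix.mulVec, hA i hqi, zero_dotProduct]
    simp [this, hqi, Real.zero_rpow hp.ne']
  · field_simp

/-- The Rademacher sums of a sample are controlled by the Rademacher process of the augmented
sample. -/
lemma expect_norm_rowFunction_rpow_le {m : ℕ} (hp : 0 < p) (hq : ∀ i, 0 ≤ q i) {w : Fin n → ℝ}
    {v l K : ℝ} (hl : 1 ≤ l) (hv : 0 ≤ v)
    (hK : 0 ≤ K) {t : Fin m → Fin n}
    (ht : ∀ z, v * ∑ k, |normalizedRow p A w (t k) ⬝ᵥ z| ^ p ≤ K * ∑ i, |A i ⬝ᵥ z| ^ p)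
    (s : Fin N → Fin n) :
    𝔼 σ : Fin N → ℤˣ, ‖∑ k, ((σ k : ℤ) : ℝ) • rowFunction hp A hq (s k)‖ ^ l ≤
      (1 + K + samplingError p A (samplingMatrix p q s)) ^ l *
        𝔼 ρ : Fin (N + m) → ℤˣ, rademacherMax p (augmentedMatrix p A w q v s t) ρ ^ l := by
  set B := augmentedMatrix p A w q v s t with hB
  set R := 1 + K + samplingError p A (samplingMatrix p q s) with hR
  -- On the unit sphere of `A` the sampled rows contribute at most `1` plus the sampling error, the
  -- appended rows at most `K`. Homogeneity then passes to the unit sphere of `B` at the cost of a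
  -- factor `R`.
  have hsum : ∀ x : {x : Fin d → ℝ // lpNorm p (A *ᵥ x) = 1},
      ∑ j, |(B *ᵥ x.1) j| ^ p ≤ R := fun x => by
    have h1 := (abs_le.1 (abs_lpNorm_rpow_sub_one_le_samplingError hp hq s x.2)).2
    rw [lpNorm_sampling_rpow hp hq] at h1
    have h2 := ht x.1
    have h3 : ∑ i, |A i ⬝ᵥ x.1| ^ p = 1 := sum_eq_one_of_lpNorm_eq_one hp x.2
    rw [h3, Finset.mul_sum] at h2
    rw [Fin.sum_univ_add]
    simp_rw [hB, abs_augmentedMatrix_castAdd_rpow hp hq, abs_augmentedMatrix_natAdd_rpow hp hv]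
    linarith
  set T : Fin m → lp (fun _ : {x : Fin d → ℝ // lpNorm p (A *ᵥ x) = 1} => ℝ) ⊤ := fun j =>
    boundedFunction (fun x => |(B *ᵥ x.1) (Fin.natAdd N j)| ^ p) ⟨R, fun x => by
      rw [abs_of_nonneg (by positivity)]
      exact (Finset.single_le_sum (f := fun j => |(B *ᵥ x.1) j| ^ p) (fun j _ => by positivity)
        (Finset.mem_univ _)).trans (hsum x)⟩ with hT
  have happ : ∀ j x, Fin.append (fun k => rowFunction hp A hq (s k)) T j x =
      |(B *ᵥ x.1) j| ^ p := fun j x => by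
    refine Fin.addCases (fun k => ?_) (fun j => ?_) j
    · rw [Fin.append_left, hB, abs_augmentedMatrix_castAdd_rpow hp hq]
      rfl
    · rw [Fin.append_right]
      rfl
  refine (expect_norm_rpow_le_append hl (fun k => rowFunction hp A hq (s k)) T).trans ?_
  rw [Finset.mul_expect]
  refine Finset.expect_le_expect fun ρ _ => ?_
  have hR0 : 0 ≤ R := add_nonneg (by linarith) (samplingError_nonneg p A _)
  rw [← Real.mul_rpow hR0 (rademacherMax_nonneg _ _ _)]
  refine Real.rpow_le_rpow (norm_nonneg _) ?_ (by linarith)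
  refine lp.norm_le_of_forall_le (mul_nonneg hR0 (rademacherMax_nonneg _ _ _)) fun x => ?_
  rw [sum_smul_apply, Real.norm_eq_abs]
  simp_rw [happ]
  exact abs_sum_sign_mul_le_rademacherMax hp B ρ (hsum x)

end Moments

section MomentBound

variable {n N m d : ℕ} {p : ℝ} {A : Matrix (Fin n) (Fin d) ℝ} {w q : Fin n → ℝ}

/-- The recursive moment bound for the sampling error. -/
theorem sampleExpectation_samplingError_le {p₀ l ε δ W : ℝ} (hp₀ : 0 < p₀) (hp : p₀ ≤ p)
    (hp2 : p < 2) (hd : 0 < d) (hN : 0 < N) (hl : 1 ≤ l) (hm : 8 * d ^ 2 ≤ m)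
    (hmW : 2 * ((d : ℝ) / m) ≤ W) (hB : UniformMomentBound p (N + m) d W l ε δ)
    (h : IsLewisWeights p A w) (hq : ∀ i, 0 ≤ q i) (hwq : ∀ i, w i ≤ W * q i)
    (hqN : ∑ i, q i = N) :
    sampleExpectation p q (fun S : Matrix (Fin N) (Fin n) ℝ => samplingError p A S ^ l) ≤
      2 ^ l * (2 ^ l / 2 * (ε ^ l * δ) *
        ((1 + 32 * (4 + Real.log 4 / p₀)) ^ l + sampleExpectation p q
          (fun S : Matrix (Fin N) (Fin n) ℝ => samplingError p A S ^ l))) := by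
  have hp0 : 0 < p := hp₀.trans_le hp
  have hm0 : 0 < m := lt_of_lt_of_le (by positivity) hm
  have hlog4 : 0 < Real.log 4 := Real.log_pos (by norm_num)
  have hv : 0 < 2 * ((d : ℝ) / m) := by positivity
  -- The appended rows depend on `A` only, and are the same for every sample `s`.
  obtain ⟨t, ht1, ht2⟩ := h.exists_sparsification hd hm hp₀ hp hp2
  have ht1' : ∀ z, z ⬝ᵥ (lewisGram p A w *ᵥ z) ≤
      2 * ((d : ℝ) / m) * ∑ k, (normalizedRow p A w (t k) ⬝ᵥ z) ^ 2 := fun z => by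
    rw [mul_assoc]
    exact ht1 z
  have ht2' : ∀ z, 2 * ((d : ℝ) / m) * ∑ k, |normalizedRow p A w (t k) ⬝ᵥ z| ^ p ≤
      32 * (4 + Real.log 4 / p₀) * ∑ i, |A i ⬝ᵥ z| ^ p := fun z => by
    linarith [ht2 z]
  have hA : ∀ i, q i = 0 → A i = 0 := fun i hi => by
    refine h.row_eq_zero hp0 (le_antisymm ?_ (h.nonneg i))
    simpa [hi] using hwq i
  have hP : ∀ s : Fin N → Fin n, 0 ≤ ∏ k, q (s k) / N := fun s =>
    Finset.prod_nonneg fun k _ => div_nonneg (hq _) N.cast_nonneg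
  have hP1 := sum_prod_eq_one (sum_div_eq_one hN hqN) N
  have hsymm := sum_norm_sub_rpow_le_rademacher hl (fun i => div_nonneg (hq i) N.cast_nonneg)
    (sum_div_eq_one hN hqN) (rowFunction hp0 A hq)
    (sum_sampleProb_smul_rowFunction hp0 hq hN hqN hA)
  simp_rw [← samplingError_eq_norm hp0 hq] at hsymm
  have hbound : ∀ s : Fin N → Fin n,
      𝔼 σ : Fin N → ℤˣ, ‖∑ k, ((σ k : ℤ) : ℝ) • rowFunction hp0 A hq (s k)‖ ^ l ≤
        2 ^ l / 2 * (ε ^ l * δ) * ((1 + 32 * (4 + Real.log 4 / p₀)) ^ l +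
          samplingError p A (samplingMatrix p q s) ^ l) := by
    intro s
    obtain ⟨w', hw', hwW⟩ :=
      exists_isLewisWeights_augmentedMatrix hp0 hp2 h hv hmW hq hwq ht1' s
    have hη := hB _ w' hw' hwW
    have hη0 : 0 ≤ ε ^ l * δ := le_trans
      (Finset.expect_nonneg fun ρ _ => Real.rpow_nonneg (rademacherMax_nonneg _ _ _) _) hη
    have hZ := samplingError_nonneg p A (samplingMatrix p q s)
    have hk : 0 ≤ 1 + 32 * (4 + Real.log 4 / p₀) := by positivity
    calc _ ≤ (1 + 32 * (4 + Real.log 4 / p₀) + samplingError p A (samplingMatrix p q s)) ^ l *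
          (ε ^ l * δ) :=
          (expect_norm_rowFunction_rpow_le hp0 hq hl hv.le (by positivity) ht2' s).trans
            (mul_le_mul_of_nonneg_left hη (by positivity))
      _ ≤ 2 ^ l / 2 * ((1 + 32 * (4 + Real.log 4 / p₀)) ^ l +
            samplingError p A (samplingMatrix p q s) ^ l) * (ε ^ l * δ) :=
          mul_le_mul_of_nonneg_right (add_rpow_le_two_rpow_mul hl hk hZ) hη0
      _ = _ := by ring
  refine hsymm.trans (mul_le_mul_of_nonneg_left ?_ (by positivity))
  refine (Finset.sum_le_sum fun s _ => mul_le_mul_of_nonneg_left (hbound s) (hP s)).trans_eq ?_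
  simp only [sampleExpectation, sampleProb_eq]
  have hmean : ∀ b : ℝ, ∀ f : (Fin N → Fin n) → ℝ,
      b + ∑ s, (∏ k, q (s k) / N) * f s = ∑ s, (∏ k, q (s k) / N) * (b + f s) := fun b f => by
    simp_rw [mul_add]
    rw [Finset.sum_add_distrib, ← Finset.sum_mul, hP1, one_mul]
  rw [hmean, Finset.mul_sum]
  exact Finset.sum_congr rfl fun s _ => mul_left_comm _ _ _

/-- A bound on the sampling error gives a multiplicative approximation of all norms. -/
lemma approx_of_samplingError_le {p₀ ε : ℝ} (hp₀ : 0 < p₀) (hp : p₀ ≤ p) (hp2 : p < 2)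
    (hε : 0 < ε) (hε1 : ε ≤ 1) (hq : ∀ i, 0 ≤ q i) {s : Fin N → Fin n}
    (h : samplingError p A (samplingMatrix p q s) ≤ p₀ / 4 * ε) (x : Fin d → ℝ) :
    Approx (1 + ε) (lpNorm p (A *ᵥ x)) (lpNorm p ((samplingMatrix p q s * A) *ᵥ x)) := by
  have hp0 : 0 < p := hp₀.trans_le hp
  set F := ∑ i, |(A *ᵥ x) i| ^ p with hF
  set G := ∑ k, |((samplingMatrix p q s * A) *ᵥ x) k| ^ p with hG
  set κ := p₀ / 4 * ε with hκ
  have hκ0 : 0 < κ := by positivity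
  have hκ1 : κ ≤ 1 / 2 := by
    rw [hκ]
    nlinarith
  have hF0 : 0 ≤ F := Finset.sum_nonneg fun i _ => by positivity
  have hG0 : 0 ≤ G := Finset.sum_nonneg fun i _ => by positivity
  have hFG : |G - F| ≤ κ * F := by
    rcases hF0.eq_or_lt with h0 | h0
    · have hAx : A *ᵥ x = 0 := by
        ext i
        have h1 := (Finset.sum_eq_zero_iff_of_nonneg (fun i _ => by positivity)).1 h0.symm i
          (Finset.mem_univ i)
        rw [Real.rpow_eq_zero_iff_of_nonneg (abs_nonneg _)] at h1
        simpa using h1.1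
      have hG' : G = 0 := by
        rw [hG, ← Matrix.mulVec_mulVec, hAx]
        simp [Real.zero_rpow hp0.ne']
      rw [hG', ← h0]
      simp
    · obtain ⟨r, hr0, hrp, hr⟩ := exists_smul_lpNorm_eq_one hp0 A h0
      have h1 := (abs_lpNorm_rpow_sub_one_le_samplingError hp0 hq s hr).trans h
      have h2 : lpNorm p ((samplingMatrix p q s * A) *ᵥ (r • x)) ^ p = F⁻¹ * G := by
        rw [lpNorm_rpow hp0, hG, Finset.mul_sum]
        refine Finset.sum_congr rfl fun k _ => ?_
        rw [Matrix.mulVec_smul, Pi.smul_apply, smul_eq_mul, abs_mul, abs_of_nonneg hr0,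
          Real.mul_rpow hr0 (abs_nonneg _), hrp]
      rw [h2] at h1
      have h3 : G - F = F * (F⁻¹ * G - 1) := by field_simp
      rw [h3, abs_mul, abs_of_pos h0, mul_comm κ]
      exact mul_le_mul_of_nonneg_left h1 h0.le
  -- From `log (1 + ε) ≥ ε / 2` and `p₀ ≤ p`, which explains the factor `p₀ / 4` in `κ`.
  have hpow : 1 + 2 * κ ≤ (1 + ε) ^ p := by
    have h1 := Real.one_sub_inv_le_log_of_pos (show 0 < 1 + ε by linarith)
    have h2 : ε / 2 ≤ 1 - (1 + ε)⁻¹ := by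
      have : 1 - (1 + ε)⁻¹ = ε / (1 + ε) := by field_simp; ring
      rw [this]
      exact div_le_div_of_nonneg_left hε.le (by linarith) (by linarith)
    rw [Real.rpow_def_of_pos (by linarith)]
    refine le_trans ?_ (Real.add_one_le_exp _)
    have h3 : ε / 2 * p ≤ Real.log (1 + ε) * p :=
      mul_le_mul_of_nonneg_right (h2.trans h1) hp0.le
    rw [hκ]
    nlinarith
  have h1ε : 0 ≤ 1 + ε := by linarith
  have hroot : ∀ a b : ℝ, 0 ≤ a → 0 ≤ b → a ≤ (1 + ε) ^ p * b →
      a ^ (1 / p) ≤ (1 + ε) * b ^ (1 / p) := fun a b ha hb hab => by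
    refine (Real.rpow_le_rpow ha hab (by positivity)).trans_eq ?_
    rw [Real.mul_rpow (by positivity) hb, ← Real.rpow_mul h1ε, mul_one_div_cancel hp0.ne',
      Real.rpow_one]
  obtain ⟨h4, h5⟩ := abs_le.1 hFG
  constructor
  · rw [one_div_mul_eq_div, div_le_iff₀' (by linarith)]
    refine hroot F G hF0 hG0 ?_
    have h6 : (1 - κ) * F ≤ G := by linarith
    have h7 : (1 + 2 * κ) * G ≤ (1 + ε) ^ p * G := mul_le_mul_of_nonneg_right hpow hG0
    have h8 : (1 + 2 * κ) * ((1 - κ) * F) ≤ (1 + 2 * κ) * G :=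
      mul_le_mul_of_nonneg_left h6 (by linarith)
    -- This is where `κ ≤ 1 / 2` is used.
    have h9 : 1 ≤ (1 + 2 * κ) * (1 - κ) := by nlinarith
    have h10 : 1 * F ≤ (1 + 2 * κ) * (1 - κ) * F := mul_le_mul_of_nonneg_right h9 hF0
    linarith
  · refine hroot G F hG0 hF0 ?_
    have h7 : (1 + 2 * κ) * F ≤ (1 + ε) ^ p * F := mul_le_mul_of_nonneg_right hpow hF0
    have h8 : 0 ≤ κ * F := by positivity
    linarith

/-- Markov's inequality for the random sampling matrix. -/
lemma one_sub_le_sampleProbability {F : Matrix (Fin N) (Fin n) ℝ → ℝ}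
    {E : Matrix (Fin N) (Fin n) ℝ → Prop} {l η δ : ℝ} (hl : 0 ≤ l) (hη : 0 < η) (hN : 0 < N)
    (hq : ∀ i, 0 ≤ q i) (hqN : ∑ i, q i = N) (hF : ∀ S, 0 ≤ F S)
    (hFE : ∀ s : Fin N → Fin n, F (samplingMatrix p q s) ≤ η → E (samplingMatrix p q s))
    (h : sampleExpectation p q (fun S => F S ^ l) ≤ η ^ l * δ) :
    1 - δ ≤ sampleProbability p q E := by
  have hηl : 0 < η ^ l := Real.rpow_pos_of_pos hη l
  have hP : ∀ s : Fin N → Fin n, 0 ≤ sampleProb q s := fun s =>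
    Finset.prod_nonneg fun k _ => div_nonneg (hq _) N.cast_nonneg
  have hP1 : ∑ s : Fin N → Fin n, sampleProb q s = 1 :=
    sum_prod_eq_one (sum_div_eq_one hN hqN) N
  have h1 : η ^ l * (1 - sampleProbability p q E) ≤ sampleExpectation p q (fun S => F S ^ l) := by
    rw [← hP1, sampleProbability, sampleExpectation, ← Finset.sum_sub_distrib, Finset.mul_sum]
    refine Finset.sum_le_sum fun s _ => ?_
    split_ifs with hE
    · rw [sub_self, mul_zero]
      exact mul_nonneg (hP s) (Real.rpow_nonneg (hF _) _)
    · have hlt : η ≤ F (samplingMatrix p q s) := le_of_lt (lt_of_not_ge fun hle => hE (hFE s hle))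
      rw [sub_zero, mul_comm]
      exact mul_le_mul_of_nonneg_left (Real.rpow_le_rpow hη.le hlt hl) (hP s)
  have h2 := le_of_mul_le_mul_left (h1.trans h) hηl
  linarith

/-- The divisor `4 k / κ` absorbs the factor `4 ^ l` and leaves `(κ ε / k) ^ l`. The `k ^ l` term
becomes half the target, and the term in `a` at most `a / 2`, which moves to the left. -/
lemma le_of_le_recursive {a k κ ε δ l : ℝ} (ha : 0 ≤ a) (hk : 1 ≤ k) (hκ : 0 < κ) (hκ1 : κ ≤ 1)
    (hε : 0 < ε) (hε1 : ε ≤ 1) (hδ : 0 < δ) (hδ1 : δ ≤ 1) (hl : 1 ≤ l)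
    (h : a ≤ 2 ^ l * (2 ^ l / 2 * ((ε / (4 * k / κ)) ^ l * δ) * (k ^ l + a))) :
    a ≤ (κ * ε) ^ l * δ := by
  have hk0 : 0 < k := by linarith
  have h1 : (2 : ℝ) ^ l * 2 ^ l * (ε / (4 * k / κ)) ^ l = (κ * ε / k) ^ l := by
    rw [← Real.mul_rpow (by norm_num) (by norm_num), ← Real.mul_rpow (by norm_num) (by positivity)]
    congr 1
    field_simp
    norm_num
  have h2 : (κ * ε / k) ^ l * k ^ l = (κ * ε) ^ l := by
    rw [← Real.mul_rpow (by positivity) hk0.le, div_mul_cancel₀ _ hk0.ne']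
  have h3 : (κ * ε / k) ^ l ≤ 1 := by
    refine Real.rpow_le_one (by positivity) ?_ (by linarith)
    rw [div_le_one hk0]
    nlinarith
  have h4 : 2 ^ l * (2 ^ l / 2 * ((ε / (4 * k / κ)) ^ l * δ) * (k ^ l + a)) =
      1 / 2 * ((κ * ε) ^ l * δ + (κ * ε / k) ^ l * (δ * a)) := by
    rw [← h2, ← h1]
    ring
  have h5 : (κ * ε / k) ^ l * (δ * a) ≤ 1 * (1 * a) := by gcongr
  rw [h4] at h
  linarith

end MomentBound

end LewisSampling

end

/-! ### Choice of the constants and conclusion -/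

theorem lemma8p5 (p₀ : ℝ) (hp₀ : 0 < p₀) :
    ∃ C₂ : ℝ, 0 < C₂ ∧ ∀ c : ℝ, 0 < c → ∃ C₁ : ℕ,
      ∀ (p : ℝ), p₀ ≤ p → p < 2 →
      ∀ (g : ℝ → ℕ → ℕ → ℝ → ℝ → ℝ) (N d : ℕ) (ε δ l : ℝ),
        0 < d → 0 < ε → ε ≤ 1 → 0 < δ → δ ≤ 1 → 1 ≤ l →
        c / d ≤ 1 / g p (N + C₁ * d ^ 2) d (ε / C₂) δ →
        LewisSampling.UniformMomentBound p (N + C₁ * d ^ 2) d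
          (1 / g p (N + C₁ * d ^ 2) d (ε / C₂) δ) l (ε / C₂) δ →
      ∀ (n : ℕ) (A : Matrix (Fin n) (Fin d) ℝ) (w q : Fin n → ℝ),
        LewisSampling.IsLewisWeights p A w →
        (∀ i, g p (N + C₁ * d ^ 2) d (ε / C₂) δ * w i ≤ q i) →
        ∑ i, q i = N →
        LewisSampling.sampleExpectation p q
            (fun S : Matrix (Fin N) (Fin n) ℝ => LewisSampling.samplingError p A S ^ l)
          ≤ ε ^ l * δ ∧
        1 - δ ≤ LewisSampling.sampleProbability p q
            (fun S : Matrix (Fin N) (Fin n) ℝ =>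
              ∀ x : Fin d → ℝ, LewisSampling.Approx (1 + ε)
                (LewisSampling.lpNorm p (A *ᵥ x))
                (LewisSampling.lpNorm p ((S * A) *ᵥ x))) := by
  set k : ℝ := 1 + 32 * (4 + Real.log 4 / p₀) with hk
  have hlog4 : 0 < Real.log 4 := Real.log_pos (by norm_num)
  have hk1 : 1 ≤ k := by
    have : 0 ≤ 32 * (4 + Real.log 4 / p₀) := by positivity
    linarith
  -- In `C₂`, the factor `p₀ / 4` converts an error in `p`-th powers into one in norms. In `C₁`, the
  -- `8` allows the sparsification and `2 / c` ensures `2 d / m = 2 / (C₁ d) ≤ c / d ≤ 1 / U`.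
  refine ⟨4 * k / (p₀ / 4), by positivity, fun c hc => ⟨max 8 ⌈2 / c⌉₊, ?_⟩⟩
  intro p hp hp2 g N d ε δ l hd hε hε1 hδ hδ1 hl hcd hB n A w q hA hgq hqN
  set C₁ : ℕ := max 8 ⌈2 / c⌉₊ with hC₁
  have hp0 : 0 < p := hp₀.trans_le hp
  have hd' : (0 : ℝ) < d := by exact_mod_cast hd
  set U := g p (N + C₁ * d ^ 2) d (ε / (4 * k / (p₀ / 4))) δ with hU
  have hU0 : 0 < U := one_div_pos.1 ((div_pos hc hd').trans_le hcd)
  have hq : ∀ i, 0 ≤ q i := fun i => (mul_nonneg hU0.le (hA.nonneg i)).trans (hgq i)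
  have hwq : ∀ i, w i ≤ 1 / U * q i := fun i => by
    rw [one_div_mul_eq_div, le_div_iff₀' hU0]
    exact hgq i
  -- As `d > 0`, some Lewis weight is positive, which forces a positive `q i`.
  have hN : 0 < N := by
    obtain ⟨i, hi⟩ := hA.exists_pos hp0 hd
    have h1 : 0 < q i := (mul_pos hU0 hi).trans_le (hgq i)
    have h2 : (0 : ℝ) < N := by
      rw [← hqN]
      exact Finset.sum_pos' (fun j _ => hq j) ⟨i, Finset.mem_univ i, h1⟩
    exact_mod_cast h2
  have hm : 8 * d ^ 2 ≤ C₁ * d ^ 2 := Nat.mul_le_mul_right _ (le_max_left _ _)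
  have hmU : 2 * ((d : ℝ) / (C₁ * d ^ 2 : ℕ)) ≤ 1 / U := by
    refine le_trans ?_ hcd
    have h1 : 2 / c ≤ C₁ := (Nat.le_ceil _).trans (by exact_mod_cast le_max_right _ _)
    have h2 : (0 : ℝ) < C₁ := (by positivity : 0 < 2 / c).trans_le h1
    rw [div_le_iff₀ hc] at h1
    push_cast
    rw [← mul_div_assoc, div_le_div_iff₀ (by positivity) hd']
    calc 2 * (d : ℝ) * d = 2 * d ^ 2 := by ring
      _ ≤ C₁ * c * d ^ 2 := by gcongr
      _ = _ := by ring
  have hmain := LewisSampling.le_of_le_recursive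
    (Finset.sum_nonneg fun s _ => mul_nonneg
      (Finset.prod_nonneg fun k _ => div_nonneg (hq _) N.cast_nonneg)
      (Real.rpow_nonneg (LewisSampling.samplingError_nonneg p A _) _))
    hk1 (by positivity) (by linarith) hε hε1 hδ hδ1 hl
    (LewisSampling.sampleExpectation_samplingError_le hp₀ hp hp2 hd hN hl hm hmU hB hA hq hwq hqN)
  refine ⟨hmain.trans ?_, ?_⟩
  · have h1 : p₀ / 4 * ε ≤ ε := mul_le_of_le_one_left hε.le (by linarith)
    gcongr
  · exact LewisSampling.one_sub_le_sampleProbability (by linarith) (by positivity) hN hq hqN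
      (LewisSampling.samplingError_nonneg p A)
      (fun s hs => LewisSampling.approx_of_samplingError_le hp₀ hp hp2 hε hε1 hq hs) hmain
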